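/- **Theorem 1 (Optimal protocol).** Let $P_1,P_2>0$ and let the fading state $\mathbf s=(s_0,s_1,s_2)$ consist of independent nonnegative gains with probability densities $f_0,f_1,f_2$ and finite means. Write $C(x)=\log_2(1+x)$. A *protocol* consists of measurable functions of $\mathbf s$, with values in the following sets for all states with $s_0,s_1,s_2>0$: mode selection variables $q_1,q_2,q_3\in\{0,1\}$ with $q_1+q_2+q_3=1$, and power fractions in $[0,1]$, namely $\alpha^{(1)}_1+\alpha^{(1)}_2=1$, $\beta^{(2)}_1+\beta^{(2)}_2=1$, $\alpha^{(3)}_1+\alpha^{(3)}_2+\alpha^{(3)}_3=1$, $\beta^{(3)}_1+\beta^{(3)}_2+\beta^{(3)}_3=1$. Put $\alpha^{(1)}=\alpha^{(1)}_1$, $\beta^{(2)}=\beta^{(2)}_1$, $\alpha^{(3)}=\alpha^{(3)}_1+\alpha^{(3)}_2$, $\beta^{(3)}=\beta^{(3)}_1+\beta^{(3)}_2$. The instantaneous capacities are $$C_{12}^{c}=C\Big(\tfrac{\alpha^{(1)}_1P_1s_0}{1+\alpha^{(1)}_2P_1s_0}\Big),\quad C_{1d}^{c}=C\Big(\tfrac{\alpha^{(1)}_1P_1s_1}{1+\alpha^{(1)}_2P_1s_1}\Big),\quad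 C_{1d}^{nc}=C(\alpha^{(1)}_2P_1s_1),$$ $$C_{21}^{c}=C\Big(\tfrac{\beta^{(2)}_1P_2s_0}{1+\beta^{(2)}_2P_2s_0}\Big),\quad C_{2d}^{c}=C\Big(\tfrac{\beta^{(2)}_1P_2s_2}{1+\beta^{(2)}_2P_2s_2}\Big),\quad C_{2d}^{nc}=C(\beta^{(2)}_2P_2s_2),$$ $$C_{sum}^{nc}=C(\alpha^{(3)}_3P_1s_1+\beta^{(3)}_3P_2s_2),\qquad C_{sum}^{c}=C\Big(P_1s_1+P_2s_2+2\sqrt{\alpha^{(3)}\beta^{(3)}P_1P_2s_1s_2}\Big).$$ A bar denotes the average over the fading with the mode indicator: $\bar C_{12}^{c}=E\{q_1C_{12}^{c}\}$, $\bar C_{1d}^{c}=E\{q_1C_{1d}^{c}\}$, $\bar C_{1d}^{nc}=E\{q_1C_{1d}^{nc}\}$, likewise with $q_2$ for $C_{21}^{c},C_{2d}^{c},C_{2d}^{nc}$ and with $q_3$ for $C_{sum}^{nc},C_{sum}^{c}$. The *sum-rate problem* is to maximize $\bar C_{sum}^{nc}+\bar C_{1d}^{nc}+\bar C_{2d}^{nc}+\bar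 C_{12}^{c}+\bar C_{21}^{c}$ over all protocols subject to $$\bar C_{sum}^{nc}+\bar C_{12}^{c}+\bar C_{21}^{c}=\bar C_{sum}^{c}+\bar C_{1d}^{c}+\bar C_{2d}^{c}.$$ For $\mu\in(\frac12,1)$, with $x=P_1s_1$ and $y=P_2s_2$, let $$\mathcal K_1=\{\min\{x,y\}\ge(\mu-\tfrac12)(1+x+y)\},\qquad \mathcal K_2=\Big\{\min\Big\{\sqrt{\tfrac yx},\sqrt{\tfrac xy}\Big\}\ge\tfrac{1-\mu}{\mu}\big[1+(\sqrt x+\sqrt y)^2\big]\Big\},$$ $$\mathcal K_3=\Big\{\sqrt{\tfrac yx}<\tfrac{1-\mu}{\mu}\big[1+(\sqrt x+\sqrt y)^2\big],\ y<(\mu-\tfrac12)(1+x+y)\Big\},$$ $$\mathcal K_4=\Big\{\sqrt{\tfrac xy}<\tfrac{1-\mu}{\mu}\big[1+(\sqrt x+\sqrt y)^2\big],\ x\le(\mu-\tfrac12)(1+x+y)\Big\},$$ and define the selection metrics $$\Lambda_1=(1-\mu)C_{12}^{c}+\mu C_{1d}^{c},\quad \Lambda_2=(1-\mu)C_{21}^{c}+\mu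 C_{2d}^{c},\quad \Lambda_3=(1-\mu)C_{sum}^{nc}+\mu C_{sum}^{c}.$$ A protocol *follows the rule with weight $\mu$* if in every state with positive gains the selected mode maximizes $\Lambda_k(\mathbf s)$ over $k$, $\alpha^{(1)}=\beta^{(2)}=1$, and $$\alpha^{(3)}=\begin{cases}1,&\mathbf s\in\mathcal K_2\cup\mathcal K_4\\ \Big[\frac{-b_1+\sqrt{b_1^2+4a_1c_1}}{2a_1}\Big]^2,&\mathbf s\in\mathcal K_3\\ (\mu-\frac12)\frac{1+x+y}{x},&\mathbf s\in\mathcal K_1,\end{cases}\qquad \beta^{(3)}=\begin{cases}1,&\mathbf s\in\mathcal K_2\cup\mathcal K_3\\ \Big[\frac{-b_2+\sqrt{b_2^2+4a_2c_2}}{2a_2}\Big]^2,&\mathbf s\in\mathcal K_4\\ (\mu-\frac12)\frac{1+x+y}{y},&\mathbf s\in\mathcal K_1,\end{cases}$$ where $a_1=\frac{2-\mu}{\mu}x$, $b_1=\frac{1-\mu}{\mu}\sqrt{\frac xy}(1+x+y)$, $c_1=1+x$, $a_2=\frac{2-\mu}{\mu}y$, $b_2=\frac{1-\mu}{\mu}\sqrt{\frac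 yx}(1+x+y)$, $c_2=1+y$. (The splits of $\alpha^{(3)}$ into $\alpha^{(3)}_1,\alpha^{(3)}_2$ and of $\beta^{(3)}$ into $\beta^{(3)}_1,\beta^{(3)}_2$ are arbitrary.) Then: 1. For every $\mu\in(\frac12,1)$, the sets $\mathcal K_1,\dots,\mathcal K_4$ cover all states with positive gains, there is a protocol that follows the rule with weight $\mu$, and for every such protocol the maximizing mode is unique for almost every state. 2. For every $\mu\in(\frac12,1)$, every protocol that follows the rule with weight $\mu$ and satisfies the balance equation $$E\big\{q_1(C_{12}^{c}-C_{1d}^{c})+q_2(C_{21}^{c}-C_{2d}^{c})+q_3(C_{sum}^{nc}-C_{sum}^{c})\big\}=0$$ solves the sum-rate problem. 3. Suppose that, with positive probability, $\frac12\big(C(P_1s_0)+C(P_1s_1)\big)>C(P_1s_1+P_2s_2)$ or $\frac12\big(C(P_2s_0)+C(P_2s_2)\big)>C(P_1s_1+P_2s_2)$. Then there is a constant $\mu\in(\frac12,1)$ such that every protocol that follows the rule with weight $\mu$ satisfies the balance equation (and hence is optimal, by 2). -/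

import Mathlib

open MeasureTheory Set

noncomputable section

namespace Backhaul

/-- A fading state `(s₀, s₁, s₂)`: the squared channel gains of the link between the two base
stations, of the link from BS 1 to the macro BS, and of the link from BS 2 to the macro BS. -/
abbrev State : Type := ℝ × ℝ × ℝ

/-- The fading states with (strictly) positive gains; almost every state is of this kind. -/
def posStates : Set State := {s | 0 < s.1 ∧ 0 < s.2.1 ∧ 0 < s.2.2}

/-- `f` is the probability density function of a nonnegative random gain with finite mean. -/
structure IsGainDensity (f : ℝ → ℝ) : Prop where
  measurable : Measurable f
  nonneg : ∀ t, 0 ≤ f t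
  zero_of_neg : ∀ t, t < 0 → f t = 0
  integral_eq_one : ∫ t, f t = 1
  finite_mean : Integrable (fun t => t * f t)

/-- The law on the real line with density `f`. -/
def gainLaw (f : ℝ → ℝ) : Measure ℝ := volume.withDensity (fun t => ENNReal.ofReal (f t))

/-- The law of the fading state: the three gains are independent with densities
`f₀`, `f₁`, `f₂`. -/
def fadingLaw (f₀ f₁ f₂ : ℝ → ℝ) : Measure State :=
  (gainLaw f₀).prod ((gainLaw f₁).prod (gainLaw f₂))

/-- `C(x) = log₂ (1 + x)`. -/
def Cap (x : ℝ) : ℝ := Real.logb 2 (1 + x)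

/-- A protocol: mode selection variables and power sharing variables, as functions of the fading
state. Indices start at `0`: `q 0`, `q 1`, `q 2` belong to the modes `M₁`, `M₂`, `M₃`.
In mode `M₁`, `α₁ 0` and `α₁ 1` are the fractions of the power of BS 1 for its cooperative and its
non-cooperative codeword; `β₂` is the same for BS 2 in mode `M₂`. In mode `M₃`, `α₃ 0`, `α₃ 1`
are the fractions of the power of BS 1 for the two cooperative codewords and `α₃ 2` is the fraction
for its non-cooperative codeword; `β₃` is the same for BS 2. -/
structure Protocol where
  q : Fin 3 → State → ℝ
  α₁ : Fin 2 → State → ℝ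
  β₂ : Fin 2 → State → ℝ
  α₃ : Fin 3 → State → ℝ
  β₃ : Fin 3 → State → ℝ

/-- Measurable nonnegative fractions that add up to one in each state. -/
def IsPowerSharing {n : ℕ} (a : Fin n → State → ℝ) : Prop :=
  (∀ j, Measurable (a j)) ∧
    ∀ s ∈ posStates, (∀ j, a j s ∈ Icc (0 : ℝ) 1) ∧ ∑ j, a j s = 1

/-- Exactly one mode is selected in each state, in a measurable way. -/
def IsModeSelection (q : Fin 3 → State → ℝ) : Prop :=
  (∀ k, Measurable (q k)) ∧
    ∀ s ∈ posStates, (∀ k, q k s = 0 ∨ q k s = 1) ∧ ∑ k, q k s = 1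

namespace Protocol

/-- The constraints `q ∈ 𝒬`, `α ∈ 𝒜`, `β ∈ ℬ`. -/
structure Admissible (p : Protocol) : Prop where
  q : IsModeSelection p.q
  α₁ : IsPowerSharing p.α₁
  β₂ : IsPowerSharing p.β₂
  α₃ : IsPowerSharing p.α₃
  β₃ : IsPowerSharing p.β₃

/-! Instantaneous capacities, for transmit powers `P₁`, `P₂`. -/

def C12c (P₁ : ℝ) (p : Protocol) (s : State) : ℝ :=
  Cap (p.α₁ 0 s * P₁ * s.1 / (1 + p.α₁ 1 s * P₁ * s.1))

def C1dc (P₁ : ℝ) (p : Protocol) (s : State) : ℝ :=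
  Cap (p.α₁ 0 s * P₁ * s.2.1 / (1 + p.α₁ 1 s * P₁ * s.2.1))

def C1dnc (P₁ : ℝ) (p : Protocol) (s : State) : ℝ :=
  Cap (p.α₁ 1 s * P₁ * s.2.1)

def C21c (P₂ : ℝ) (p : Protocol) (s : State) : ℝ :=
  Cap (p.β₂ 0 s * P₂ * s.1 / (1 + p.β₂ 1 s * P₂ * s.1))

def C2dc (P₂ : ℝ) (p : Protocol) (s : State) : ℝ :=
  Cap (p.β₂ 0 s * P₂ * s.2.2 / (1 + p.β₂ 1 s * P₂ * s.2.2))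

def C2dnc (P₂ : ℝ) (p : Protocol) (s : State) : ℝ :=
  Cap (p.β₂ 1 s * P₂ * s.2.2)

def Csumnc (P₁ P₂ : ℝ) (p : Protocol) (s : State) : ℝ :=
  Cap (p.α₃ 2 s * P₁ * s.2.1 + p.β₃ 2 s * P₂ * s.2.2)

def Csumc (P₁ P₂ : ℝ) (p : Protocol) (s : State) : ℝ :=
  Cap (P₁ * s.2.1 + P₂ * s.2.2 +
    2 * √((p.α₃ 0 s + p.α₃ 1 s) * (p.β₃ 0 s + p.β₃ 1 s) * P₁ * P₂ * s.2.1 * s.2.2))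

/-- The average over the fading of the capacity `c` in the time slots where mode `k` is selected. -/
def avg (law : Measure State) (p : Protocol) (k : Fin 3) (c : State → ℝ) : ℝ :=
  ∫ s, p.q k s * c s ∂law

/-- The objective: the average sum rate. -/
def sumRate (law : Measure State) (P₁ P₂ : ℝ) (p : Protocol) : ℝ :=
  p.avg law 2 (p.Csumnc P₁ P₂) + p.avg law 0 (p.C1dnc P₁) + p.avg law 1 (p.C2dnc P₂)
    + p.avg law 0 (p.C12c P₁) + p.avg law 1 (p.C21c P₂)

/-- The constraint: the virtual queue is balanced. -/
def QueueBalance (law : Measure State) (P₁ P₂ : ℝ) (p : Protocol) : Prop :=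
  p.avg law 2 (p.Csumnc P₁ P₂) + p.avg law 0 (p.C12c P₁) + p.avg law 1 (p.C21c P₂)
    = p.avg law 2 (p.Csumc P₁ P₂) + p.avg law 0 (p.C1dc P₁) + p.avg law 1 (p.C2dc P₂)

/-- The feasible set of the sum rate problem. -/
def feasible (law : Measure State) (P₁ P₂ : ℝ) : Set Protocol :=
  {p | p.Admissible ∧ p.QueueBalance law P₁ P₂}

/-- `p` solves the sum rate maximization problem. -/
def IsOptimal (law : Measure State) (P₁ P₂ : ℝ) (p : Protocol) : Prop :=
  p ∈ feasible law P₁ P₂ ∧ IsMaxOn (sumRate law P₁ P₂) (feasible law P₁ P₂) p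

/-- The selection metrics of the three modes. -/
def metric (P₁ P₂ μ : ℝ) (p : Protocol) (s : State) : Fin 3 → ℝ :=
  ![(1 - μ) * p.C12c P₁ s + μ * p.C1dc P₁ s,
    (1 - μ) * p.C21c P₂ s + μ * p.C2dc P₂ s,
    (1 - μ) * p.Csumnc P₁ P₂ s + μ * p.Csumc P₁ P₂ s]

/-- The equation which determines the selection weight. -/
def BalanceEquation (law : Measure State) (P₁ P₂ : ℝ) (p : Protocol) : Prop :=
  ∫ s, (p.q 0 s * (p.C12c P₁ s - p.C1dc P₁ s) + p.q 1 s * (p.C21c P₂ s - p.C2dc P₂ s)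
    + p.q 2 s * (p.Csumnc P₁ P₂ s - p.Csumc P₁ P₂ s)) ∂law = 0

end Protocol

/-! The four fading regions. -/

def K₁ (P₁ P₂ μ : ℝ) : Set State :=
  {s | (μ - 1 / 2) * (1 + P₁ * s.2.1 + P₂ * s.2.2) ≤ min (P₁ * s.2.1) (P₂ * s.2.2)}

def K₂ (P₁ P₂ μ : ℝ) : Set State :=
  {s | (1 - μ) / μ * (1 + (√(P₁ * s.2.1) + √(P₂ * s.2.2)) ^ 2)
      ≤ min √(P₂ * s.2.2 / (P₁ * s.2.1)) √(P₁ * s.2.1 / (P₂ * s.2.2))}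

def K₃ (P₁ P₂ μ : ℝ) : Set State :=
  {s | √(P₂ * s.2.2 / (P₁ * s.2.1)) < (1 - μ) / μ * (1 + (√(P₁ * s.2.1) + √(P₂ * s.2.2)) ^ 2) ∧
    P₂ * s.2.2 < (μ - 1 / 2) * (1 + P₁ * s.2.1 + P₂ * s.2.2)}

def K₄ (P₁ P₂ μ : ℝ) : Set State :=
  {s | √(P₁ * s.2.1 / (P₂ * s.2.2)) < (1 - μ) / μ * (1 + (√(P₁ * s.2.1) + √(P₂ * s.2.2)) ^ 2) ∧
    P₁ * s.2.1 ≤ (μ - 1 / 2) * (1 + P₁ * s.2.1 + P₂ * s.2.2)}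

/-- `[(-b + √(b² + 4ac)) / (2a)]²` with `a = (2-μ)/μ·x`, `b = (1-μ)/μ·√(x/y)·(1+x+y)`,
`c = 1 + x`. -/
def quadShare (μ x y : ℝ) : ℝ :=
  let a := (2 - μ) / μ * x
  let b := (1 - μ) / μ * √(x / y) * (1 + x + y)
  let c := 1 + x
  ((-b + √(b ^ 2 + 4 * a * c)) / (2 * a)) ^ 2

/-- The protocol `p` follows the per-state rule with selection weight `μ`: a selected mode has the
largest metric, and the power sharing variables have the prescribed values, with
`α⁽³⁾ = α₃ 0 + α₃ 1` and `β⁽³⁾ = β₃ 0 + β₃ 1`. -/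
structure Protocol.FollowsRule (P₁ P₂ μ : ℝ) (p : Protocol) : Prop where
  mode : ∀ s ∈ posStates, ∀ k, p.q k s = 1 → ∀ j, p.metric P₁ P₂ μ s j ≤ p.metric P₁ P₂ μ s k
  α₁ : ∀ s ∈ posStates, p.α₁ 0 s = 1
  β₂ : ∀ s ∈ posStates, p.β₂ 0 s = 1
  α₃_full : ∀ s ∈ posStates, s ∈ K₂ P₁ P₂ μ ∪ K₄ P₁ P₂ μ → p.α₃ 0 s + p.α₃ 1 s = 1
  α₃_quad : ∀ s ∈ posStates, s ∈ K₃ P₁ P₂ μ →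
    p.α₃ 0 s + p.α₃ 1 s = quadShare μ (P₁ * s.2.1) (P₂ * s.2.2)
  α₃_lin : ∀ s ∈ posStates, s ∈ K₁ P₁ P₂ μ →
    p.α₃ 0 s + p.α₃ 1 s = (μ - 1 / 2) * ((1 + P₁ * s.2.1 + P₂ * s.2.2) / (P₁ * s.2.1))
  β₃_full : ∀ s ∈ posStates, s ∈ K₂ P₁ P₂ μ ∪ K₃ P₁ P₂ μ → p.β₃ 0 s + p.β₃ 1 s = 1
  β₃_quad : ∀ s ∈ posStates, s ∈ K₄ P₁ P₂ μ →
    p.β₃ 0 s + p.β₃ 1 s = quadShare μ (P₂ * s.2.2) (P₁ * s.2.1)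
  β₃_lin : ∀ s ∈ posStates, s ∈ K₁ P₁ P₂ μ →
    p.β₃ 0 s + p.β₃ 1 s = (μ - 1 / 2) * ((1 + P₁ * s.2.1 + P₂ * s.2.2) / (P₂ * s.2.2))

/-- The states in which, at equal weights `1/2`, exchanging data between the base stations (with
full power for the cooperative message) beats the non-cooperative transmission of both. -/
def exchangeStates (P₁ P₂ : ℝ) : Set State :=
  {s | Cap (P₁ * s.2.1 + P₂ * s.2.2) < (Cap (P₁ * s.1) + Cap (P₁ * s.2.1)) / 2 ∨
    Cap (P₁ * s.2.1 + P₂ * s.2.2) < (Cap (P₂ * s.1) + Cap (P₂ * s.2.2)) / 2}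

end Backhaul

end

noncomputable section

namespace Backhaul

/-! The optimality statement is Lagrangian duality with a zero gap. Subtracting `μ` times the queue
imbalance from the sum rate turns each relay rate into `(1-μ)·relay + μ·destination`, so the problem
decouples into one maximization per fading state. A feasible protocol has sum rate equal to the mean
of its `lagrangian` (`integral_lagrangian`). Statewise this is at most the Lagrangian of any
protocol that follows the rule (`lagrangian_le`, `le_lagrangian`), and integration gives optimality.

Two facts solve the problem in one state. In modes `M₁` and `M₂`, splitting the power is no better
than pure cooperation or pure direct transmission (`split_le`), and the latter loses to `M₃` without
cooperation. In `M₃` the metric is bounded by tangents of the concave logarithm and by a weighted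
AM-GM inequality, so the Karush-Kuhn-Tucker conditions are sufficient (`isBestShare_of_kkt`); the
four regions are the four ways of satisfying them.

For the existence of `μ`, the metrics are almost surely distinct, since ties form null sets
(`ae_injective_ruleMetric`). Hence the mean drift of the queue depends on `μ` alone. It is
continuous on `[1/2, 1]`, because in almost every state the chosen rate pair is the unique maximizer
over a fixed compact set. It is positive at `1/2` if exchange pays with positive probability, and
negative at `1`. The intermediate value theorem supplies an interior zero. Both end weights are
needed there, which is why most lemmas allow the closed interval. -/

/-! ### The capacity function -/

lemma Cap_zero : Cap 0 = 0 := by simp [Cap]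

lemma Cap_strictMonoOn : StrictMonoOn Cap (Ici 0) := by
  intro a ha b hb hab
  exact Real.logb_lt_logb (by norm_num) (by linarith [mem_Ici.1 ha]) (by linarith)

lemma Cap_lt {a b : ℝ} (ha : 0 ≤ a) (hab : a < b) : Cap a < Cap b :=
  Cap_strictMonoOn ha (ha.trans hab.le) hab

lemma Cap_le {a b : ℝ} (ha : 0 ≤ a) (hab : a ≤ b) : Cap a ≤ Cap b :=
  Cap_strictMonoOn.monotoneOn ha (ha.trans hab) hab

lemma Cap_nonneg {a : ℝ} (ha : 0 ≤ a) : 0 ≤ Cap a := by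
  simpa [Cap_zero] using Cap_le le_rfl ha

lemma Cap_inj {a b : ℝ} (ha : 0 ≤ a) (hb : 0 ≤ b) (h : Cap a = Cap b) : a = b :=
  Cap_strictMonoOn.injOn ha hb h

/-- Since `1 / log 2 < 2`, rates are bounded linearly in the gains, so finite means are enough for
integrability. -/
lemma Cap_le_two_mul {a : ℝ} (ha : 0 ≤ a) : Cap a ≤ 2 * a := by
  have h2 := Real.log_two_gt_d9
  have h := Real.log_le_sub_one_of_pos (show 0 < 1 + a by linarith)
  rw [Cap, Real.logb, div_le_iff₀ (by linarith)]
  nlinarith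

lemma measurable_Cap : Measurable Cap := by
  unfold Cap Real.logb; fun_prop

lemma continuousOn_Cap : ContinuousOn Cap (Ici 0) := by
  unfold Cap Real.logb
  refine ContinuousOn.div_const (ContinuousOn.log (by fun_prop) ?_) _
  intro x hx
  linarith [mem_Ici.1 hx]

/-- Superposition coding: the rates of the two codewords add up to the single-user capacity. -/
lemma Cap_div_one_add {a b z : ℝ} (hb : 0 ≤ b) (hab : a + b = 1) (hz : 0 ≤ z) :
    Cap (a * z / (1 + b * z)) = Cap z - Cap (b * z) := by
  have h1 : 0 < 1 + b * z := by positivity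
  unfold Cap
  rw [← Real.logb_div (by positivity) h1.ne']
  congr 1
  field_simp
  rw [show a = 1 - b by linarith]; ring

lemma Cap_le_tangent {u v : ℝ} (hu : 0 ≤ u) (hv : 0 ≤ v) :
    Cap u ≤ Cap v + (u - v) / (1 + v) / Real.log 2 := by
  have h2 : 0 < Real.log 2 := Real.log_pos (by norm_num)
  have hlog := Real.log_le_sub_one_of_pos (show 0 < (1 + u) / (1 + v) by positivity)
  rw [Real.log_div (by positivity) (by positivity)] at hlog
  have : (1 + u) / (1 + v) - 1 = (u - v) / (1 + v) := by field_simp; ring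
  unfold Cap Real.logb
  rw [← add_div]
  gcongr
  linarith

/-- Strict concavity is what makes the rates of an optimal power sharing unique. -/
lemma Cap_lt_tangent {u v : ℝ} (hu : 0 ≤ u) (hv : 0 ≤ v) (huv : u ≠ v) :
    Cap u < Cap v + (u - v) / (1 + v) / Real.log 2 := by
  have h2 : 0 < Real.log 2 := Real.log_pos (by norm_num)
  have hne : (1 + u) / (1 + v) ≠ 1 := by
    intro h
    rw [div_eq_one_iff_eq (by positivity)] at h
    exact huv (by linarith)
  have hlog := Real.log_lt_sub_one_of_pos (show 0 < (1 + u) / (1 + v) by positivity) hne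
  rw [Real.log_div (by positivity) (by positivity)] at hlog
  have : (1 + u) / (1 + v) - 1 = (u - v) / (1 + v) := by field_simp; ring
  unfold Cap Real.logb
  rw [← add_div]
  gcongr
  linarith

/-! ### Optimal power sharing in mode `M₃` -/

/-- The rate of the non-cooperative codewords in mode `M₃`, with received powers `x`, `y` and
cooperative shares `a`, `b`. -/
def ncRate (x y a b : ℝ) : ℝ := Cap ((1 - a) * x + (1 - b) * y)

/-- The total rate in mode `M₃`. -/
def coopRate (x y a b : ℝ) : ℝ := Cap (x + y + 2 * √(a * b * (x * y)))

/-- `(a, b)` maximizes the metric of mode `M₃`, and all maximizers have the same rates. -/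
structure IsBestShare (μ x y a b : ℝ) : Prop where
  left : a ∈ Icc (0 : ℝ) 1
  right : b ∈ Icc (0 : ℝ) 1
  le : ∀ a' ∈ Icc (0 : ℝ) 1, ∀ b' ∈ Icc (0 : ℝ) 1,
    (1 - μ) * ncRate x y a' b' + μ * coopRate x y a' b'
      ≤ (1 - μ) * ncRate x y a b + μ * coopRate x y a b
  unique : ∀ a' ∈ Icc (0 : ℝ) 1, ∀ b' ∈ Icc (0 : ℝ) 1,
    (1 - μ) * ncRate x y a b + μ * coopRate x y a b
      ≤ (1 - μ) * ncRate x y a' b' + μ * coopRate x y a' b' →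
    ncRate x y a' b' = ncRate x y a b ∧ coopRate x y a' b' = coopRate x y a b

lemma ncRate_comm (x y a b : ℝ) : ncRate y x b a = ncRate x y a b := by
  unfold ncRate; rw [add_comm]

lemma coopRate_comm (x y a b : ℝ) : coopRate y x b a = coopRate x y a b := by
  unfold coopRate; rw [add_comm y x, mul_comm b a, mul_comm y x]

lemma IsBestShare.symm {μ x y a b : ℝ} (h : IsBestShare μ x y a b) : IsBestShare μ y x b a where
  left := h.right
  right := h.left
  le a' ha b' hb := by
    simpa only [ncRate_comm x y, coopRate_comm x y] using h.le b' hb a' ha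
  unique a' ha b' hb := by
    simpa only [ncRate_comm x y, coopRate_comm x y] using h.unique b' hb a' ha

lemma ncArg_nonneg {x y a b : ℝ} (hx : 0 ≤ x) (hy : 0 ≤ y) (ha : a ∈ Icc (0 : ℝ) 1)
    (hb : b ∈ Icc (0 : ℝ) 1) : 0 ≤ (1 - a) * x + (1 - b) * y :=
  add_nonneg (mul_nonneg (by linarith [ha.2]) hx) (mul_nonneg (by linarith [hb.2]) hy)

/-- The Karush-Kuhn-Tucker conditions are sufficient: the shares are `a = d²/x`, `b = e²/y`. -/
lemma isBestShare_of_kkt {μ x y a b d e r : ℝ} (hμ : 1 / 2 ≤ μ) (hμ1 : μ < 1) (hx : 0 < x)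
    (hy : 0 < y) (ha : a ∈ Icc (0 : ℝ) 1) (hb : b ∈ Icc (0 : ℝ) 1) (hd : 0 ≤ d) (he : 0 ≤ e)
    (had : a * x = d ^ 2) (hbe : b * y = e ^ 2) (hr : 0 < r) (hre : e = r * d)
    (h1 : (1 - μ) * (1 + x + y + 2 * d * e) ≤ μ * r * (1 + x + y - d ^ 2 - e ^ 2))
    (h1' : (1 - μ) * (1 + x + y + 2 * d * e) = μ * r * (1 + x + y - d ^ 2 - e ^ 2) ∨ a = 1)
    (h2 : (1 - μ) * r * (1 + x + y + 2 * d * e) ≤ μ * (1 + x + y - d ^ 2 - e ^ 2))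
    (h2' : (1 - μ) * r * (1 + x + y + 2 * d * e) = μ * (1 + x + y - d ^ 2 - e ^ 2) ∨ b = 1) :
    IsBestShare μ x y a b := by
  have hlog2 : 0 < Real.log 2 := Real.log_pos (by norm_num)
  have hsq : √(a * b * (x * y)) = d * e := by
    rw [show a * b * (x * y) = (a * x) * (b * y) by ring, had, hbe, ← mul_pow,
      Real.sqrt_sq (by positivity)]
  have hN0 : 0 ≤ (1 - a) * x + (1 - b) * y := ncArg_nonneg hx.le hy.le ha hb
  have hN : 1 + ((1 - a) * x + (1 - b) * y) = 1 + x + y - d ^ 2 - e ^ 2 := by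
    rw [← had, ← hbe]; ring
  have hM0 : 0 ≤ x + y + 2 * (d * e) := by positivity
  -- With both capacities replaced by their tangents at `(a, b)`, up to the factor `1 / log 2`, no
  -- other choice of shares gains anything.
  have key : ∀ a' ∈ Icc (0 : ℝ) 1, ∀ b' ∈ Icc (0 : ℝ) 1,
      (1 - μ) * (((1 - a') * x + (1 - b') * y - ((1 - a) * x + (1 - b) * y)) /
        (1 + ((1 - a) * x + (1 - b) * y)))
      + μ * ((x + y + 2 * √(a' * b' * (x * y)) - (x + y + 2 * (d * e))) /
        (1 + (x + y + 2 * (d * e)))) ≤ 0 := by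
    intro a' ha' b' hb'
    -- Weighted AM-GM replaces the square root by a function linear in the shares. It is tight at
    -- `(a, b)`, where `e = r * d` makes both terms equal to `r * d ^ 2`.
    have hsqrt : √(a' * b' * (x * y)) ≤ (r * (a' * x) + (b' * y) / r) / 2 := by
      apply Real.sqrt_le_iff.2
      have h1 : 0 ≤ a' * x := mul_nonneg ha'.1 hx.le
      have h2 : 0 ≤ b' * y := mul_nonneg hb'.1 hy.le
      refine ⟨by positivity, ?_⟩
      have h3 : r * (a' * x) * ((b' * y) / r) = a' * b' * (x * y) := by field_simp
      nlinarith [sq_nonneg (r * (a' * x) - (b' * y) / r)]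
    set N := 1 + x + y - d ^ 2 - e ^ 2 with hNdef
    set M := 1 + x + y + 2 * d * e with hMdef
    have hNpos : 0 < N := by linarith
    have hMpos : 0 < M := by positivity
    rw [hN, show 1 + (x + y + 2 * (d * e)) = M by rw [hMdef]; ring]
    have e1 : (1 - a') * x + (1 - b') * y - ((1 - a) * x + (1 - b) * y)
        = (a * x - a' * x) + (b * y - b' * y) := by ring
    have e2 : r * (a * x) + b * y / r = 2 * (d * e) := by
      rw [had, hbe, hre]; field_simp; ring
    -- Complementary slackness: the first factor is nonnegative, and it vanishes unless the share is
    -- already at its upper end `1`.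
    have g1 : (μ * r * N - (1 - μ) * M) * (a' * x - a * x) ≤ 0 := by
      rcases h1' with h | h
      · rw [h]; simp
      · refine mul_nonpos_of_nonneg_of_nonpos (by linarith) ?_
        rw [h]; nlinarith [ha'.2]
    have g2 : (μ * N - (1 - μ) * r * M) * ((b' * y - b * y) / r) ≤ 0 := by
      rcases h2' with h | h
      · rw [h]; simp
      · refine mul_nonpos_of_nonneg_of_nonpos (by linarith) ?_
        refine div_nonpos_of_nonpos_of_nonneg ?_ hr.le
        rw [h]; nlinarith [hb'.2]
    rw [e1, mul_div_assoc', mul_div_assoc', div_add_div _ _ hNpos.ne' hMpos.ne']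
    refine div_nonpos_of_nonpos_of_nonneg ?_ (by positivity)
    have e3 : x + y + 2 * √(a' * b' * (x * y)) - (x + y + 2 * (d * e))
        ≤ r * (a' * x - a * x) + (b' * y - b * y) / r := by
      rw [sub_div, mul_sub]; linarith
    have e4 : r * ((b' * y - b * y) / r) = b' * y - b * y := by field_simp
    have e5 := mul_le_mul_of_nonneg_left e3 (show 0 ≤ μ * N by nlinarith)
    have e6 : (μ * N - (1 - μ) * r * M) * ((b' * y - b * y) / r) =
      μ * N * ((b' * y - b * y) / r) - (1 - μ) * M * (r * ((b' * y - b * y) / r)) := by ring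
    rw [e4] at e6
    linarith
  have key' : ∀ a' ∈ Icc (0 : ℝ) 1, ∀ b' ∈ Icc (0 : ℝ) 1,
      (1 - μ) * (((1 - a') * x + (1 - b') * y - ((1 - a) * x + (1 - b) * y)) /
        (1 + ((1 - a) * x + (1 - b) * y)) / Real.log 2)
      + μ * ((x + y + 2 * √(a' * b' * (x * y)) - (x + y + 2 * (d * e))) /
        (1 + (x + y + 2 * (d * e))) / Real.log 2) ≤ 0 := by
    intro a' ha' b' hb'
    have h := div_nonpos_of_nonpos_of_nonneg (key a' ha' b' hb') hlog2.le
    rwa [add_div, mul_div_assoc, mul_div_assoc (μ)] at h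
  refine ⟨ha, hb, ?_, ?_⟩
  · intro a' ha' b' hb'
    have t1 := Cap_le_tangent (ncArg_nonneg hx.le hy.le ha' hb') hN0
    have t2 := Cap_le_tangent (show 0 ≤ x + y + 2 * √(a' * b' * (x * y)) by positivity) hM0
    have k := key' a' ha' b' hb'
    unfold ncRate coopRate
    rw [hsq]
    have t1' := mul_le_mul_of_nonneg_left t1 (show 0 ≤ 1 - μ by linarith)
    have t2' := mul_le_mul_of_nonneg_left t2 (show 0 ≤ μ by linarith)
    linarith
  · intro a' ha' b' hb' hle
    have t1 := Cap_le_tangent (ncArg_nonneg hx.le hy.le ha' hb') hN0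
    have t2 := Cap_le_tangent (show 0 ≤ x + y + 2 * √(a' * b' * (x * y)) by positivity) hM0
    have k := key' a' ha' b' hb'
    unfold ncRate coopRate at hle ⊢
    rw [hsq] at hle ⊢
    have t1' := mul_le_mul_of_nonneg_left t1 (show 0 ≤ 1 - μ by linarith)
    have t2' := mul_le_mul_of_nonneg_left t2 (show 0 ≤ μ by linarith)
    -- If either argument of `Cap` differed, the corresponding tangent bound would be strict and the
    -- competitor would fall short; both weights are positive.
    constructor
    · congr 1
      by_contra hne
      have t := Cap_lt_tangent (ncArg_nonneg hx.le hy.le ha' hb') hN0 hne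
      have t' := mul_lt_mul_of_pos_left t (show 0 < 1 - μ by linarith)
      linarith
    · congr 1
      by_contra hne
      have t := Cap_lt_tangent (show 0 ≤ x + y + 2 * √(a' * b' * (x * y)) by positivity) hM0 hne
      have t' := mul_lt_mul_of_pos_left t (show 0 < μ by linarith)
      linarith

/-- At weight one, full cooperation is best. -/
lemma isBestShare_one {x y : ℝ} (hx : 0 < x) (hy : 0 < y) : IsBestShare 1 x y 1 1 := by
  have hxy : 0 < x * y := mul_pos hx hy
  have hab : ∀ a ∈ Icc (0 : ℝ) 1, ∀ b ∈ Icc (0 : ℝ) 1, a * b ≤ 1 :=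
    fun a ha b hb => mul_le_one₀ ha.2 hb.1 hb.2
  refine ⟨by simp, by simp, ?_, ?_⟩
  · intro a ha b hb
    have := hab a ha b hb
    simp only [sub_self, zero_mul, zero_add, one_mul]
    refine Cap_le (by positivity) ?_
    have hs : √(a * b * (x * y)) ≤ √(1 * 1 * (x * y)) := Real.sqrt_le_sqrt (by nlinarith)
    linarith
  · intro a ha b hb hle
    simp only [sub_self, zero_mul, zero_add, one_mul] at hle
    have h1 : a * b = 1 := by
      by_contra hne
      have hlt := lt_of_le_of_ne (hab a ha b hb) hne
      refine absurd hle (not_le.2 (Cap_lt (by positivity) ?_))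
      have : √(a * b * (x * y)) < √(1 * 1 * (x * y)) := by
        refine Real.sqrt_lt_sqrt (mul_nonneg (mul_nonneg ha.1 hb.1) hxy.le) ?_
        nlinarith
      linarith
    have ha1 : a = 1 := le_antisymm ha.2 (by nlinarith [ha.1, ha.2, hb.1, hb.2])
    have hb1 : b = 1 := by rw [ha1] at h1; linarith
    rw [ha1, hb1]; exact ⟨rfl, rfl⟩

lemma sqrt_div_sq_sq {p q : ℝ} (hp : 0 ≤ p) (hq : 0 ≤ q) : √(p ^ 2 / q ^ 2) = p / q := by
  rw [← div_pow, Real.sqrt_sq (by positivity)]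

lemma exists_sq_eq {x : ℝ} (hx : 0 < x) : ∃ p, 0 < p ∧ x = p ^ 2 :=
  ⟨√x, Real.sqrt_pos.2 hx, (Real.sq_sqrt hx.le).symm⟩

/-- The power of the cooperative codewords prescribed by `quadShare`, as the square of the positive
root `d` of the stationarity condition. -/
lemma exists_quadShare_mul_eq {μ p q : ℝ} (hμ : 1 / 2 ≤ μ) (hμ1 : μ ≤ 1) (hp : 0 < p)
    (hq : 0 < q) : ∃ d, 0 < d ∧ quadShare μ (p ^ 2) (q ^ 2) * p ^ 2 = d ^ 2 ∧
      (1 - μ) * d * (1 + p ^ 2 + q ^ 2 + 2 * d * q) = μ * q * (1 + p ^ 2 - d ^ 2) := by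
  have hμ0 : 0 < μ := by linarith
  set a := (2 - μ) / μ * p ^ 2 with ha
  set b := (1 - μ) / μ * (p / q) * (1 + p ^ 2 + q ^ 2) with hb
  have ha0 : 0 < a := mul_pos (div_pos (by linarith) hμ0) (by positivity)
  have hb0 : 0 ≤ b :=
    mul_nonneg (mul_nonneg (div_nonneg (by linarith) hμ0.le) (by positivity)) (by positivity)
  set r := √(b ^ 2 + 4 * a * (1 + p ^ 2)) with hr
  have hr2 : r ^ 2 = b ^ 2 + 4 * a * (1 + p ^ 2) := Real.sq_sqrt (by positivity)
  have hrb : b < r := by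
    refine Real.lt_sqrt_of_sq_lt ?_
    have : 0 < 4 * a * (1 + p ^ 2) := by positivity
    linarith
  -- The positive root of `a * w ^ 2 + b * w = 1 + p ^ 2`; the prescribed share is `w ^ 2`.
  set w := (-b + r) / (2 * a) with hw
  have hw0 : 0 < w := div_pos (by linarith) (by linarith)
  have hr' : r = 2 * a * w + b := by rw [hw]; field_simp; ring
  have hquad : a * w ^ 2 + b * w = 1 + p ^ 2 := by
    rw [hr'] at hr2
    have : 4 * a * (a * w ^ 2 + b * w) = 4 * a * (1 + p ^ 2) := by linarith
    exact mul_left_cancel₀ (by positivity) this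
  refine ⟨p * w, by positivity, ?_, ?_⟩
  · have : quadShare μ (p ^ 2) (q ^ 2) = w ^ 2 := by
      simp only [quadShare, sqrt_div_sq_sq hp.le hq.le]
      rfl
    rw [this]; ring
  · have h : μ * q * (a * w ^ 2 + b * w) = μ * q * (1 + p ^ 2) := by rw [hquad]
    rw [ha, hb] at h
    field_simp at h
    linarith

/-- BS 2 is pinned at share `1`, and `d` solves stationarity for BS 1. In that equation the left
side increases and the right side decreases in `d`, so the root is located by testing it at two
points. The test at `p` uses `h1` and gives `d ≤ p`, a legitimate share. The test at `q` uses `h2`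
and gives `r = q / d ≤ 1`, from which the remaining inequality for BS 2 follows. -/
lemma isBestShare_quad {μ x y : ℝ} (hμ : 1 / 2 ≤ μ) (hμ1 : μ < 1) (hx : 0 < x) (hy : 0 < y)
    (h1 : √(y / x) ≤ (1 - μ) / μ * (1 + (√x + √y) ^ 2)) (h2 : y ≤ (μ - 1 / 2) * (1 + x + y)) :
    IsBestShare μ x y (quadShare μ x y) 1 := by
  obtain ⟨p, hp, rfl⟩ := exists_sq_eq hx
  obtain ⟨q, hq, rfl⟩ := exists_sq_eq hy
  obtain ⟨d, hd, hds, heq⟩ := exists_quadShare_mul_eq hμ hμ1.le hp hq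
  have hμ0 : 0 < μ := by linarith
  rw [sqrt_div_sq_sq hq.le hp.le, Real.sqrt_sq hp.le, Real.sqrt_sq hq.le, div_mul_eq_mul_div,
    div_le_div_iff₀ hp hμ0] at h1
  have hdp : d ≤ p := by
    by_contra! hlt
    have e1 : μ * q * (1 + p ^ 2 - d ^ 2) ≤ μ * q * 1 := by
      have : p ^ 2 ≤ d ^ 2 := by gcongr
      gcongr; linarith
    have e2 : (1 - μ) * p * (1 + p ^ 2 + q ^ 2 + 2 * p * q)
        < (1 - μ) * d * (1 + p ^ 2 + q ^ 2 + 2 * d * q) := by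
      have : 0 < 1 - μ := by linarith
      gcongr
    nlinarith
  have hqd : q ≤ d := by
    by_contra! hlt
    have e1 : μ * q * (1 + p ^ 2 - q ^ 2) < μ * q * (1 + p ^ 2 - d ^ 2) := by
      gcongr
    have e2 : (1 - μ) * d * (1 + p ^ 2 + q ^ 2 + 2 * d * q)
        < (1 - μ) * q * (1 + p ^ 2 + q ^ 2 + 2 * q * q) := by
      have : 0 < 1 - μ := by linarith
      gcongr
    have e3 := mul_le_mul_of_nonneg_left h2 hq.le
    linarith
  have hN : (1 - μ) * (1 + p ^ 2 + q ^ 2 + 2 * d * q)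
      = μ * (q / d) * (1 + p ^ 2 + q ^ 2 - d ^ 2 - q ^ 2) := by
    field_simp
    linarith
  have ha1 : quadShare μ (p ^ 2) (q ^ 2) ≤ 1 := by
    have : d ^ 2 ≤ p ^ 2 := by gcongr
    by_contra! hlt
    have := mul_lt_mul_of_pos_right hlt hx
    linarith
  have hr1 : q / d ≤ 1 := (div_le_one hd).2 hqd
  refine isBestShare_of_kkt (d := d) (e := q) (r := q / d) hμ hμ1 hx hy ⟨by
    unfold quadShare; positivity, ha1⟩ (by simp) hd.le hq.le hds (by ring) (by positivity)
    (by field_simp) hN.le (Or.inl hN) ?_ (Or.inr rfl)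
  have hNn : 0 ≤ μ * (1 + p ^ 2 + q ^ 2 - d ^ 2 - q ^ 2) := by
    have : d ^ 2 ≤ p ^ 2 := by gcongr
    refine mul_nonneg hμ0.le (by linarith)
  rw [mul_right_comm, hN]
  have : (q / d) * (q / d) ≤ 1 := mul_le_one₀ hr1 (by positivity) hr1
  nlinarith

/-- Both shares sit at their upper end, and the two bounds hidden in the minimum are exactly the two
Karush-Kuhn-Tucker inequalities. -/
lemma isBestShare_full {μ x y : ℝ} (hμ : 1 / 2 ≤ μ) (hμ1 : μ < 1) (hx : 0 < x) (hy : 0 < y)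
    (h : (1 - μ) / μ * (1 + (√x + √y) ^ 2) ≤ min √(y / x) √(x / y)) :
    IsBestShare μ x y 1 1 := by
  obtain ⟨p, hp, rfl⟩ := exists_sq_eq hx
  obtain ⟨q, hq, rfl⟩ := exists_sq_eq hy
  have hμ0 : 0 < μ := by linarith
  obtain ⟨h1, h2⟩ := le_min_iff.1 h
  rw [sqrt_div_sq_sq hq.le hp.le, Real.sqrt_sq hp.le, Real.sqrt_sq hq.le, div_mul_eq_mul_div,
    div_le_div_iff₀ hμ0 hp] at h1
  rw [sqrt_div_sq_sq hp.le hq.le, Real.sqrt_sq hp.le, Real.sqrt_sq hq.le, div_mul_eq_mul_div,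
    div_le_div_iff₀ hμ0 hq] at h2
  refine isBestShare_of_kkt (d := p) (e := q) (r := q / p) hμ hμ1 hx hy (by simp) (by simp)
    hp.le hq.le (by ring) (by ring) (by positivity) (by field_simp) ?_ (Or.inr rfl) ?_ (Or.inr rfl)
  · field_simp; linarith
  · field_simp; linarith

/-- When both conditions are equalities they force `r = 1`, so the two cooperative powers agree.
With common value `t`, stationarity reads `(1-μ)(1+x+y+2t) = μ(1+x+y-2t)`, that is `t =
(μ-1/2)(1+x+y)`. -/
lemma isBestShare_lin {μ x y : ℝ} (hμ : 1 / 2 ≤ μ) (hμ1 : μ < 1) (hx : 0 < x) (hy : 0 < y)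
    (h : (μ - 1 / 2) * (1 + x + y) ≤ min x y) :
    IsBestShare μ x y ((μ - 1 / 2) * ((1 + x + y) / x)) ((μ - 1 / 2) * ((1 + x + y) / y)) := by
  obtain ⟨h1, h2⟩ := le_min_iff.1 h
  have ht : 0 ≤ (μ - 1 / 2) * (1 + x + y) := mul_nonneg (by linarith) (by positivity)
  have hs : √((μ - 1 / 2) * (1 + x + y)) ^ 2 = (μ - 1 / 2) * (1 + x + y) := Real.sq_sqrt ht
  have e : ∀ z, 0 < z → (μ - 1 / 2) * (1 + x + y) ≤ z →
      (μ - 1 / 2) * ((1 + x + y) / z) ∈ Icc (0 : ℝ) 1 := by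
    intro z hz hle
    rw [mul_div_assoc']
    exact ⟨by positivity, (div_le_one hz).2 hle⟩
  have hM : (1 - μ) * (1 + x + y + 2 * √((μ - 1 / 2) * (1 + x + y)) *
      √((μ - 1 / 2) * (1 + x + y))) = μ * (1 + x + y - √((μ - 1 / 2) * (1 + x + y)) ^ 2
        - √((μ - 1 / 2) * (1 + x + y)) ^ 2) := by
    rw [mul_assoc 2, ← pow_two, hs]; ring
  refine isBestShare_of_kkt (d := √((μ - 1 / 2) * (1 + x + y)))
    (e := √((μ - 1 / 2) * (1 + x + y))) (r := 1) hμ hμ1 hx hy (e x hx h1) (e y hy h2)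
    (Real.sqrt_nonneg _) (Real.sqrt_nonneg _) ?_ ?_ one_pos (by ring) ?_ (Or.inl ?_) ?_ (Or.inl ?_)
  · rw [hs]; field_simp
  · rw [hs]; field_simp
  all_goals simp only [mul_one, hM, le_refl]

/-! The four fading regions, in terms of the received powers `x` and `y`. -/

/-- The region `K₁`, of linear power sharing. -/
def LinRegion (μ x y : ℝ) : Prop := (μ - 1 / 2) * (1 + x + y) ≤ min x y

/-- The region `K₂`, of full cooperation. -/
def FullRegion (μ x y : ℝ) : Prop :=
  (1 - μ) / μ * (1 + (√x + √y) ^ 2) ≤ min √(y / x) √(x / y)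

/-- The region `K₃`, where BS 1 splits its power. -/
def QuadRegionLeft (μ x y : ℝ) : Prop :=
  √(y / x) < (1 - μ) / μ * (1 + (√x + √y) ^ 2) ∧ y < (μ - 1 / 2) * (1 + x + y)

/-- The region `K₄`, where BS 2 splits its power. -/
def QuadRegionRight (μ x y : ℝ) : Prop :=
  √(x / y) < (1 - μ) / μ * (1 + (√x + √y) ^ 2) ∧ x ≤ (μ - 1 / 2) * (1 + x + y)

lemma QuadRegionLeft.lt_one {μ x y : ℝ} (h : QuadRegionLeft μ x y) : μ < 1 := by
  by_contra! h1
  have := h.1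
  have h2 : (1 - μ) / μ * (1 + (√x + √y) ^ 2) ≤ 0 :=
    mul_nonpos_of_nonpos_of_nonneg (div_nonpos_of_nonpos_of_nonneg (by linarith) (by linarith))
      (by positivity)
  linarith [Real.sqrt_nonneg (y / x)]

lemma QuadRegionRight.lt_one {μ x y : ℝ} (h : QuadRegionRight μ x y) :
    μ < 1 := by
  by_contra! h1
  have := h.1
  have h2 : (1 - μ) / μ * (1 + (√x + √y) ^ 2) ≤ 0 :=
    mul_nonpos_of_nonpos_of_nonneg (div_nonpos_of_nonpos_of_nonneg (by linarith) (by linarith))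
      (by positivity)
  linarith [Real.sqrt_nonneg (x / y)]

lemma LinRegion.lt_one {μ x y : ℝ} (hx : 0 < x) (hy : 0 < y) (h : LinRegion μ x y) : μ < 1 := by
  by_contra! h1
  obtain ⟨h2, h3⟩ := le_min_iff.1 h
  nlinarith

/-- The smaller received power has both the smaller ratio under the root and the better chance of
lying below `(μ-1/2)(1+x+y)`. So if the tests for `K₁` and `K₂` both fail, they fail for the same
station. -/
lemma region_cover {μ x y : ℝ} (hx : 0 < x) (hy : 0 < y) :
    LinRegion μ x y ∨ FullRegion μ x y ∨ QuadRegionLeft μ x y ∨ QuadRegionRight μ x y := by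
  by_contra! h
  obtain ⟨h1, h2, h3, h4⟩ := h
  simp only [LinRegion, FullRegion, QuadRegionLeft, QuadRegionRight, not_le, not_and, not_lt] at *
  have hs : x ≤ y → √(x / y) ≤ √(y / x) := fun h => Real.sqrt_le_sqrt (by
    exact ((div_le_one hy).2 h).trans ((one_le_div hx).2 h))
  have hs' : y ≤ x → √(y / x) ≤ √(x / y) := fun h => Real.sqrt_le_sqrt (by
    exact ((div_le_one hx).2 h).trans ((one_le_div hy).2 h))
  rcases lt_or_ge y ((μ - 1 / 2) * (1 + x + y)) with hyt | hyt
  · have h5 : √(x / y) < (1 - μ) / μ * (1 + (√x + √y) ^ 2) := by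
      rcases min_lt_iff.1 h2 with h | h
      · exact absurd hyt (not_lt.2 (h3 h))
      · exact h
    have h6 := h4 h5
    have h7 := hs' (by linarith)
    rcases lt_or_ge √(y / x) ((1 - μ) / μ * (1 + (√x + √y) ^ 2)) with h | h
    · linarith [h3 h]
    · linarith
  · have hxt : x < (μ - 1 / 2) * (1 + x + y) := by
      rcases min_lt_iff.1 h1 with h | h
      · exact h
      · linarith
    have h7 := hs (by linarith)
    rcases lt_or_ge √(x / y) ((1 - μ) / μ * (1 + (√x + √y) ^ 2)) with h | h
    · linarith [h4 h]
    · rcases min_lt_iff.1 h2 with h' | h' <;> linarith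

/-- On the overlap of `K₁` and `K₂` the two prescriptions agree, both being share `1`. The minimum
in `K₂` is at most `1`, which forces `p * q ≤ (μ-1/2)(1+x+y)`; by `K₁` this is at most `p ^ 2` and
`q ^ 2`, hence `p = q`. -/
lemma lin_full_overlap {μ x y : ℝ} (hμ : 1 / 2 ≤ μ) (hx : 0 < x) (hy : 0 < y)
    (h : LinRegion μ x y) (h' : FullRegion μ x y) :
    (μ - 1 / 2) * (1 + x + y) = x ∧ (μ - 1 / 2) * (1 + x + y) = y := by
  have hμ1 := h.lt_one hx hy
  obtain ⟨p, hp, rfl⟩ := exists_sq_eq hx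
  obtain ⟨q, hq, rfl⟩ := exists_sq_eq hy
  have hμ0 : 0 < μ := by linarith
  obtain ⟨h1, h2⟩ := le_min_iff.1 h'
  obtain ⟨h3, h4⟩ := le_min_iff.1 h
  rw [sqrt_div_sq_sq hq.le hp.le, Real.sqrt_sq hp.le, Real.sqrt_sq hq.le, div_mul_eq_mul_div,
    div_le_div_iff₀ hμ0 hp] at h1
  rw [sqrt_div_sq_sq hp.le hq.le, Real.sqrt_sq hp.le, Real.sqrt_sq hq.le, div_mul_eq_mul_div,
    div_le_div_iff₀ hμ0 hq] at h2
  have key : (1 - μ) * (1 + (p + q) ^ 2) ≤ μ := by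
    rcases le_total p q with hpq | hpq
    · have : (1 - μ) * (1 + (p + q) ^ 2) * q ≤ μ * q := by nlinarith
      exact le_of_mul_le_mul_right this hq
    · have : (1 - μ) * (1 + (p + q) ^ 2) * p ≤ μ * p := by nlinarith
      exact le_of_mul_le_mul_right this hp
  -- Eliminating `μ` through `key`, this reduces to `4 * p * q ≤ (p + q) ^ 2`.
  have hpq : p * q ≤ (μ - 1 / 2) * (1 + p ^ 2 + q ^ 2) := by nlinarith [sq_nonneg (p - q)]
  have hpq1 : p ≤ q := by
    have : p * q ≤ q * q := by nlinarith
    exact le_of_mul_le_mul_right this hq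
  have hpq2 : q ≤ p := by
    have : p * q ≤ p * p := by nlinarith
    exact le_of_mul_le_mul_left this hp
  have : p = q := le_antisymm hpq1 hpq2
  subst this
  constructor <;> nlinarith

/-- The quadratic and linear prescriptions agree on the common boundary, where `d = q` is the root
of the stationarity condition. This is needed, with the stations exchanged, because the non-strict
inequality in `K₄` lets it meet `K₁`. -/
lemma quadShare_of_eq {μ x y : ℝ} (hμ : 1 / 2 ≤ μ) (hμ1 : μ < 1) (hx : 0 < x) (hy : 0 < y)
    (h : y = (μ - 1 / 2) * (1 + x + y)) :
    quadShare μ x y = (μ - 1 / 2) * ((1 + x + y) / x) := by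
  obtain ⟨p, hp, rfl⟩ := exists_sq_eq hx
  obtain ⟨q, hq, rfl⟩ := exists_sq_eq hy
  obtain ⟨d, hd, hds, heq⟩ := exists_quadShare_mul_eq hμ hμ1.le hp hq
  have hq' : (1 - μ) * q * (1 + p ^ 2 + q ^ 2 + 2 * q * q) = μ * q * (1 + p ^ 2 - q ^ 2) := by
    have := congrArg (q * ·) h
    linarith
  have h1 : 0 < 1 - μ := by linarith
  have h2 : 0 < μ := by linarith
  have hdq : d = q := by
    rcases lt_trichotomy d q with hlt | heq' | hlt
    · have e1 : μ * q * (1 + p ^ 2 - q ^ 2) < μ * q * (1 + p ^ 2 - d ^ 2) := by gcongr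
      have e2 : (1 - μ) * d * (1 + p ^ 2 + q ^ 2 + 2 * d * q)
        < (1 - μ) * q * (1 + p ^ 2 + q ^ 2 + 2 * q * q) := by gcongr
      linarith
    · exact heq'
    · have e1 : μ * q * (1 + p ^ 2 - d ^ 2) < μ * q * (1 + p ^ 2 - q ^ 2) := by gcongr
      have e2 : (1 - μ) * q * (1 + p ^ 2 + q ^ 2 + 2 * q * q)
        < (1 - μ) * d * (1 + p ^ 2 + q ^ 2 + 2 * d * q) := by gcongr
      linarith
  rw [mul_div_assoc', ← h, eq_div_iff (by positivity), hds, hdq]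

/-! ### The law of the fading state -/

lemma gainLaw_ac (f : ℝ → ℝ) : gainLaw f ≪ volume := withDensity_absolutelyContinuous _ _

lemma IsGainDensity.integrable {f : ℝ → ℝ} (hf : IsGainDensity f) : Integrable f := by
  by_contra h
  have := hf.integral_eq_one
  rw [integral_undef h] at this
  exact zero_ne_one this

lemma IsGainDensity.isProbabilityMeasure {f : ℝ → ℝ} (hf : IsGainDensity f) :
    IsProbabilityMeasure (gainLaw f) := by
  constructor
  rw [gainLaw, withDensity_apply _ MeasurableSet.univ, Measure.restrict_univ,
    ← ofReal_integral_eq_lintegral_ofReal hf.integrable (Filter.Eventually.of_forall hf.nonneg),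
    hf.integral_eq_one, ENNReal.ofReal_one]

lemma IsGainDensity.ae_pos {f : ℝ → ℝ} (hf : IsGainDensity f) : ∀ᵐ t ∂(gainLaw f), 0 < t := by
  have h0 : ∀ᵐ t ∂(volume : Measure ℝ), t ≠ 0 := by
    simp [ae_iff]
  rw [gainLaw, ae_withDensity_iff hf.measurable.ennreal_ofReal]
  filter_upwards [h0] with t ht hft
  by_contra hle
  have : t < 0 := lt_of_le_of_ne (not_lt.1 hle) ht
  exact hft (by rw [hf.zero_of_neg t this, ENNReal.ofReal_zero])

lemma IsGainDensity.integrable_id {f : ℝ → ℝ} (hf : IsGainDensity f) :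
    Integrable (fun t => t) (gainLaw f) := by
  rw [gainLaw, integrable_withDensity_iff hf.measurable.ennreal_ofReal (by simp)]
  refine hf.finite_mean.congr (Filter.Eventually.of_forall fun t => ?_)
  simp [ENNReal.toReal_ofReal (hf.nonneg t)]

lemma measurableSet_posStates : MeasurableSet posStates := by
  unfold posStates
  measurability

lemma isProbabilityMeasure_fadingLaw {f₀ f₁ f₂ : ℝ → ℝ} (hf₀ : IsGainDensity f₀) (hf₁ : IsGainDensity f₁)
    (hf₂ : IsGainDensity f₂) :
    IsProbabilityMeasure (fadingLaw f₀ f₁ f₂) := by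
  have := hf₀.isProbabilityMeasure
  have := hf₁.isProbabilityMeasure
  have := hf₂.isProbabilityMeasure
  unfold fadingLaw; infer_instance

lemma ae_mem_posStates {f₀ f₁ f₂ : ℝ → ℝ} (hf₀ : IsGainDensity f₀) (hf₁ : IsGainDensity f₁)
    (hf₂ : IsGainDensity f₂) :
    ∀ᵐ s ∂(fadingLaw f₀ f₁ f₂), s ∈ posStates := by
  have := hf₀.isProbabilityMeasure
  have := hf₁.isProbabilityMeasure
  have := hf₂.isProbabilityMeasure
  have h0 := (Measure.quasiMeasurePreserving_fst (μ := gainLaw f₀)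
    (ν := (gainLaw f₁).prod (gainLaw f₂))).ae hf₀.ae_pos
  have h12 := Measure.quasiMeasurePreserving_snd (μ := gainLaw f₀)
    (ν := (gainLaw f₁).prod (gainLaw f₂))
  have h1 := h12.ae ((Measure.quasiMeasurePreserving_fst (μ := gainLaw f₁)
    (ν := gainLaw f₂)).ae hf₁.ae_pos)
  have h2 := h12.ae ((Measure.quasiMeasurePreserving_snd (μ := gainLaw f₁)
    (ν := gainLaw f₂)).ae hf₂.ae_pos)
  filter_upwards [h0, h1, h2] with s a b c using ⟨a, b, c⟩

lemma integrable_gains {f₀ f₁ f₂ : ℝ → ℝ} (hf₀ : IsGainDensity f₀) (hf₁ : IsGainDensity f₁)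
    (hf₂ : IsGainDensity f₂) :
    Integrable (fun s : State => s.1) (fadingLaw f₀ f₁ f₂) ∧
    Integrable (fun s : State => s.2.1) (fadingLaw f₀ f₁ f₂) ∧
    Integrable (fun s : State => s.2.2) (fadingLaw f₀ f₁ f₂) := by
  have := hf₀.isProbabilityMeasure
  have := hf₁.isProbabilityMeasure
  have := hf₂.isProbabilityMeasure
  refine ⟨hf₀.integrable_id.comp_fst _, ?_, ?_⟩
  · exact (hf₁.integrable_id.comp_fst (gainLaw f₂)).comp_snd (gainLaw f₀)
  · exact (hf₂.integrable_id.comp_snd (gainLaw f₁)).comp_snd (gainLaw f₀)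

/-- Fubini: each line in the direction of `s₀` meets `T` in at most one point, and a law with a
density has no atoms. -/
lemma fadingLaw_null_of_slice_fst {f₀ f₁ f₂ : ℝ → ℝ} (hf₀ : IsGainDensity f₀) (hf₁ : IsGainDensity f₁)
    (hf₂ : IsGainDensity f₂) {T : Set State} (hT : MeasurableSet T)
    (h : ∀ r : ℝ × ℝ, {t : ℝ | (t, r) ∈ T}.Subsingleton) : fadingLaw f₀ f₁ f₂ T = 0 := by
  have := hf₀.isProbabilityMeasure
  have := hf₁.isProbabilityMeasure
  have := hf₂.isProbabilityMeasure
  rw [fadingLaw, Measure.prod_apply_symm hT,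
    lintegral_eq_zero_iff (measurable_measure_prodMk_right hT)]
  exact Filter.Eventually.of_forall fun r => gainLaw_ac f₀ ((h r).measure_zero volume)

lemma fadingLaw_null_of_slice_snd_snd {f₀ f₁ f₂ : ℝ → ℝ} (hf₀ : IsGainDensity f₀) (hf₁ : IsGainDensity f₁)
    (hf₂ : IsGainDensity f₂) {T : Set State} (hT : MeasurableSet T)
    (h : ∀ t u : ℝ, {v : ℝ | (t, u, v) ∈ T}.Subsingleton) : fadingLaw f₀ f₁ f₂ T = 0 := by
  have := hf₀.isProbabilityMeasure
  have := hf₁.isProbabilityMeasure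
  have := hf₂.isProbabilityMeasure
  rw [fadingLaw, Measure.measure_prod_null hT]
  refine Filter.Eventually.of_forall fun t => ?_
  rw [Pi.zero_apply, Measure.measure_prod_null (measurable_prodMk_left hT)]
  exact Filter.Eventually.of_forall fun u => gainLaw_ac f₂ ((h t u).measure_zero volume)

/-! ### Protocols in a state with positive gains -/

namespace Protocol

/-- The share of the power of BS 1 used for the cooperative codewords in mode `M₃`. -/
def coop₁ (p : Protocol) (s : State) : ℝ := p.α₃ 0 s + p.α₃ 1 s

/-- The share of the power of BS 2 used for the cooperative codewords in mode `M₃`. -/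
def coop₂ (p : Protocol) (s : State) : ℝ := p.β₃ 0 s + p.β₃ 1 s

end Protocol

lemma IsPowerSharing.two {a : Fin 2 → State → ℝ} (h : IsPowerSharing a) {s : State}
    (hs : s ∈ posStates) : 0 ≤ a 0 s ∧ 0 ≤ a 1 s ∧ a 0 s + a 1 s = 1 := by
  obtain ⟨h1, h2⟩ := h.2 s hs
  rw [Fin.sum_univ_two] at h2
  exact ⟨(h1 0).1, (h1 1).1, h2⟩

lemma IsPowerSharing.three {a : Fin 3 → State → ℝ} (h : IsPowerSharing a) {s : State}
    (hs : s ∈ posStates) : a 0 s + a 1 s ∈ Icc (0 : ℝ) 1 ∧ a 2 s = 1 - (a 0 s + a 1 s) := by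
  obtain ⟨h1, h2⟩ := h.2 s hs
  rw [Fin.sum_univ_three] at h2
  have := (h1 0).1
  have := (h1 1).1
  have := (h1 2).1
  refine ⟨⟨?_, ?_⟩, ?_⟩ <;> linarith

lemma IsModeSelection.exists_mode {q : Fin 3 → State → ℝ} (h : IsModeSelection q) {s : State}
    (hs : s ∈ posStates) : ∃ k, q k s = 1 ∧ ∀ j, j ≠ k → q j s = 0 := by
  obtain ⟨h1, h2⟩ := h.2 s hs
  rw [Fin.sum_univ_three] at h2
  rcases h1 0 with h0 | h0 <;> rcases h1 1 with h3 | h3 <;> rcases h1 2 with h4 | h4 <;>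
    rw [h0, h3, h4] at h2 <;> norm_num at h2
  · exact ⟨2, h4, fun j hj => by fin_cases j <;> simp_all⟩
  · exact ⟨1, h3, fun j hj => by fin_cases j <;> simp_all⟩
  · exact ⟨0, h0, fun j hj => by fin_cases j <;> simp_all⟩

section Pointwise

variable {P₁ P₂ μ : ℝ} {p : Protocol} {s : State}

lemma Protocol.Admissible.Csumnc_eq (hp : p.Admissible) (hs : s ∈ posStates) :
    p.Csumnc P₁ P₂ s = ncRate (P₁ * s.2.1) (P₂ * s.2.2) (p.coop₁ s) (p.coop₂ s) := by
  rw [Protocol.Csumnc, (hp.α₃.three hs).2, (hp.β₃.three hs).2, ncRate]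
  simp only [Protocol.coop₁, Protocol.coop₂, mul_assoc]

lemma Csumc_eq :
    p.Csumc P₁ P₂ s = coopRate (P₁ * s.2.1) (P₂ * s.2.2) (p.coop₁ s) (p.coop₂ s) := by
  rw [Protocol.Csumc, coopRate]
  simp only [Protocol.coop₁, Protocol.coop₂]
  congr 4
  ring

lemma Protocol.FollowsRule.shares (h : p.FollowsRule P₁ P₂ μ) (hp : p.Admissible)
    (hs : s ∈ posStates) : p.α₁ 0 s = 1 ∧ p.α₁ 1 s = 0 ∧ p.β₂ 0 s = 1 ∧ p.β₂ 1 s = 0 := by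
  have h1 := (hp.α₁.two hs).2.2
  have h2 := (hp.β₂.two hs).2.2
  have h3 := h.α₁ s hs
  have h4 := h.β₂ s hs
  exact ⟨h3, by linarith, h4, by linarith⟩

lemma Protocol.FollowsRule.capacities (h : p.FollowsRule P₁ P₂ μ) (hp : p.Admissible)
    (hs : s ∈ posStates) : p.C12c P₁ s = Cap (P₁ * s.1) ∧ p.C1dc P₁ s = Cap (P₁ * s.2.1) ∧
      p.C1dnc P₁ s = 0 ∧ p.C21c P₂ s = Cap (P₂ * s.1) ∧ p.C2dc P₂ s = Cap (P₂ * s.2.2) ∧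
      p.C2dnc P₂ s = 0 := by
  obtain ⟨h1, h2, h3, h4⟩ := h.shares hp hs
  simp [Protocol.C12c, Protocol.C1dc, Protocol.C1dnc, Protocol.C21c, Protocol.C2dc,
    Protocol.C2dnc, h1, h2, h3, h4, Cap_zero]

end Pointwise

/-! ### A protocol which follows the rule -/

open Classical in
/-- The prescribed cooperative share of BS 1 in mode `M₃`. -/
def shareLeft (μ x y : ℝ) : ℝ :=
  if LinRegion μ x y then (μ - 1 / 2) * ((1 + x + y) / x)
  else if FullRegion μ x y ∨ QuadRegionRight μ x y then 1
  else quadShare μ x y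

open Classical in
/-- The prescribed cooperative share of BS 2 in mode `M₃`. -/
def shareRight (μ x y : ℝ) : ℝ :=
  if LinRegion μ x y then (μ - 1 / 2) * ((1 + x + y) / y)
  else if FullRegion μ x y ∨ QuadRegionLeft μ x y then 1
  else quadShare μ y x

lemma QuadRegionLeft.not_lin {μ x y : ℝ} (h : QuadRegionLeft μ x y) : ¬ LinRegion μ x y :=
  fun h' => absurd h.2 (not_lt.2 (le_min_iff.1 h').2)

lemma QuadRegionLeft.not_full {μ x y : ℝ} (h : QuadRegionLeft μ x y) : ¬ FullRegion μ x y :=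
  fun h' => absurd h.1 (not_lt.2 (le_min_iff.1 h').1)

lemma QuadRegionRight.not_full {μ x y : ℝ} (h : QuadRegionRight μ x y) : ¬ FullRegion μ x y :=
  fun h' => absurd h.1 (not_lt.2 (le_min_iff.1 h').2)

/-- This makes `K₃` and `K₄` disjoint. If `x ≤ y`, the second hypothesis gives `2(1-μ)(1+x+y) ≤ 1`,
while the first, combined with the second, gives the strict reverse inequality. -/
lemma lt_of_quad_region {μ x y : ℝ} (hμ : 1 / 2 ≤ μ) (hx : 0 < x) (hy : 0 < y)
    (h1 : √(y / x) < (1 - μ) / μ * (1 + (√x + √y) ^ 2)) (h2 : y ≤ (μ - 1 / 2) * (1 + x + y)) :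
    y < x := by
  have hμ0 : 0 < μ := by linarith
  obtain ⟨p, hp, rfl⟩ := exists_sq_eq hx
  obtain ⟨q, hq, rfl⟩ := exists_sq_eq hy
  rw [sqrt_div_sq_sq hq.le hp.le, Real.sqrt_sq hp.le, Real.sqrt_sq hq.le, div_mul_eq_mul_div,
    div_lt_div_iff₀ hp hμ0] at h1
  by_contra! hle
  have hpq : p ≤ q := le_of_sq_le_sq hle hq.le
  have hμ1 : 0 < 1 - μ := by
    by_contra! h
    have h3 : (1 - μ) * (1 + (p + q) ^ 2) * p ≤ 0 :=
      mul_nonpos_of_nonpos_of_nonneg (mul_nonpos_of_nonpos_of_nonneg h (by positivity)) hp.le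
    have h4 : 0 < q * μ := by positivity
    linarith
  have h3 : (1 - μ) * (1 + (p + q) ^ 2) * p ≤ (1 - μ) * (2 * μ * (1 + p ^ 2 + q ^ 2)) * q := by
    have h4 : p * q ≤ q * q := by gcongr
    gcongr
    linarith
  have h5 : 1 * (q * μ) < 2 * (1 - μ) * (1 + p ^ 2 + q ^ 2) * (q * μ) := by linarith
  have h6 := lt_of_mul_lt_mul_right h5 (by positivity)
  linarith

lemma QuadRegionLeft.lt {μ x y : ℝ} (hμ : 1 / 2 ≤ μ) (hx : 0 < x) (hy : 0 < y)
    (h : QuadRegionLeft μ x y) : y < x :=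
  lt_of_quad_region hμ hx hy h.1 h.2.le

lemma QuadRegionRight.lt {μ x y : ℝ} (hμ : 1 / 2 ≤ μ) (hx : 0 < x) (hy : 0 < y)
    (h : QuadRegionRight μ x y) : x < y :=
  lt_of_quad_region hμ hy hx (by rw [add_comm √y]; exact h.1) (by linarith [h.2])

lemma shareLeft_of_lin {μ x y : ℝ} (h : LinRegion μ x y) :
    shareLeft μ x y = (μ - 1 / 2) * ((1 + x + y) / x) := if_pos h

lemma shareRight_of_lin {μ x y : ℝ} (h : LinRegion μ x y) :
    shareRight μ x y = (μ - 1 / 2) * ((1 + x + y) / y) := if_pos h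

/-- The linear branch is tested first in `shareLeft`, so on the overlap with `K₂` or `K₄` its
formula has to produce `1`. -/
lemma shareLeft_of_full {μ x y : ℝ} (hμ : 1 / 2 ≤ μ) (hx : 0 < x) (hy : 0 < y)
    (h : FullRegion μ x y ∨ QuadRegionRight μ x y) : shareLeft μ x y = 1 := by
  by_cases hl : LinRegion μ x y
  · have ht : (μ - 1 / 2) * (1 + x + y) = x := by
      rcases h with h | h
      · exact (lin_full_overlap hμ hx hy hl h).1
      · exact le_antisymm (le_min_iff.1 hl).1 h.2
    rw [shareLeft_of_lin hl, mul_div_assoc', ht, div_self hx.ne']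
  · rw [shareLeft, if_neg hl, if_pos h]

lemma shareLeft_of_quad {μ x y : ℝ} (hμ : 1 / 2 ≤ μ) (hx : 0 < x) (hy : 0 < y)
    (h : QuadRegionLeft μ x y) : shareLeft μ x y = quadShare μ x y := by
  rw [shareLeft, if_neg h.not_lin, if_neg]
  rintro (h' | h')
  · exact h.not_full h'
  · exact (h.lt hμ hx hy).asymm (h'.lt hμ hx hy)

lemma shareRight_of_full {μ x y : ℝ} (hμ : 1 / 2 ≤ μ) (hx : 0 < x) (hy : 0 < y)
    (h : FullRegion μ x y ∨ QuadRegionLeft μ x y) : shareRight μ x y = 1 := by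
  by_cases hl : LinRegion μ x y
  · have ht : (μ - 1 / 2) * (1 + x + y) = y := by
      rcases h with h | h
      · exact (lin_full_overlap hμ hx hy hl h).2
      · exact absurd hl h.not_lin
    rw [shareRight_of_lin hl, mul_div_assoc', ht, div_self hy.ne']
  · rw [shareRight, if_neg hl, if_pos h]

lemma shareRight_of_quad {μ x y : ℝ} (hμ : 1 / 2 ≤ μ) (hx : 0 < x) (hy : 0 < y)
    (h : QuadRegionRight μ x y) : shareRight μ x y = quadShare μ y x := by
  by_cases hl : LinRegion μ x y
  · have ht : (μ - 1 / 2) * (1 + x + y) = x := le_antisymm (le_min_iff.1 hl).1 h.2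
    rw [shareRight_of_lin hl, quadShare_of_eq hμ h.lt_one hy hx (by linarith), add_right_comm 1 y x]
  · rw [shareRight, if_neg hl, if_neg]
    rintro (h' | h')
    · exact h.not_full h'
    · exact (h.lt hμ hx hy).asymm (h'.lt hμ hx hy)

lemma isBestShare_share {μ x y : ℝ} (hμ : μ ∈ Icc (1 / 2 : ℝ) 1) (hx : 0 < x) (hy : 0 < y) :
    IsBestShare μ x y (shareLeft μ x y) (shareRight μ x y) := by
  rcases region_cover (μ := μ) hx hy with hr | hr | hr | hr
  · rw [shareLeft_of_lin hr, shareRight_of_lin hr]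
    exact isBestShare_lin hμ.1 (hr.lt_one hx hy) hx hy hr
  · rw [shareLeft_of_full hμ.1 hx hy (Or.inl hr), shareRight_of_full hμ.1 hx hy (Or.inl hr)]
    rcases hμ.2.lt_or_eq with h1 | rfl
    · exact isBestShare_full hμ.1 h1 hx hy hr
    · exact isBestShare_one hx hy
  · rw [shareLeft_of_quad hμ.1 hx hy hr, shareRight_of_full hμ.1 hx hy (Or.inr hr)]
    exact isBestShare_quad hμ.1 hr.lt_one hx hy hr.1.le hr.2.le
  · rw [shareLeft_of_full hμ.1 hx hy (Or.inr hr), shareRight_of_quad hμ.1 hx hy hr]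
    refine (isBestShare_quad hμ.1 hr.lt_one hy hx ?_ ?_).symm
    · rw [add_comm √y]; exact hr.1.le
    · linarith [hr.2]

lemma Protocol.FollowsRule.coop_eq {P₁ P₂ μ : ℝ} {p : Protocol} {s : State}
    (h : p.FollowsRule P₁ P₂ μ) (hP₁ : 0 < P₁) (hP₂ : 0 < P₂) (hμ : μ ∈ Icc (1 / 2 : ℝ) 1)
    (hs : s ∈ posStates) : p.coop₁ s = shareLeft μ (P₁ * s.2.1) (P₂ * s.2.2) ∧
      p.coop₂ s = shareRight μ (P₁ * s.2.1) (P₂ * s.2.2) := by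
  have hx : 0 < P₁ * s.2.1 := mul_pos hP₁ hs.2.1
  have hy : 0 < P₂ * s.2.2 := mul_pos hP₂ hs.2.2
  unfold Protocol.coop₁ Protocol.coop₂
  rcases region_cover (μ := μ) hx hy with hr | hr | hr | hr
  · rw [shareLeft_of_lin hr, shareRight_of_lin hr]
    exact ⟨h.α₃_lin s hs hr, h.β₃_lin s hs hr⟩
  · rw [shareLeft_of_full hμ.1 hx hy (Or.inl hr), shareRight_of_full hμ.1 hx hy (Or.inl hr)]
    exact ⟨h.α₃_full s hs (Or.inl hr), h.β₃_full s hs (Or.inl hr)⟩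
  · rw [shareLeft_of_quad hμ.1 hx hy hr, shareRight_of_full hμ.1 hx hy (Or.inr hr)]
    exact ⟨h.α₃_quad s hs hr, h.β₃_full s hs (Or.inr hr)⟩
  · rw [shareLeft_of_full hμ.1 hx hy (Or.inr hr), shareRight_of_quad hμ.1 hx hy hr]
    exact ⟨h.α₃_full s hs (Or.inr hr), h.β₃_quad s hs hr⟩

lemma measurable_shareLeft (μ : ℝ) : Measurable fun z : ℝ × ℝ => shareLeft μ z.1 z.2 := by
  have h1 : MeasurableSet {z : ℝ × ℝ | LinRegion μ z.1 z.2} :=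
    measurableSet_le (by fun_prop) (by fun_prop)
  have h2 : MeasurableSet {z : ℝ × ℝ | FullRegion μ z.1 z.2} :=
    measurableSet_le (by fun_prop) (by fun_prop)
  have h3 : MeasurableSet {z : ℝ × ℝ | QuadRegionRight μ z.1 z.2} :=
    MeasurableSet.inter (s₁ := {z : ℝ × ℝ | √(z.1 / z.2) < (1 - μ) / μ * (1 + (√z.1 + √z.2) ^ 2)})
      (s₂ := {z : ℝ × ℝ | z.1 ≤ (μ - 1 / 2) * (1 + z.1 + z.2)})
      (measurableSet_lt (by fun_prop) (by fun_prop)) (measurableSet_le (by fun_prop) (by fun_prop))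
  unfold shareLeft quadShare
  refine Measurable.ite h1 (by fun_prop) (Measurable.ite (h2.union h3) (by fun_prop) (by fun_prop))

lemma measurable_shareRight (μ : ℝ) : Measurable fun z : ℝ × ℝ => shareRight μ z.1 z.2 := by
  have h1 : MeasurableSet {z : ℝ × ℝ | LinRegion μ z.1 z.2} :=
    measurableSet_le (by fun_prop) (by fun_prop)
  have h2 : MeasurableSet {z : ℝ × ℝ | FullRegion μ z.1 z.2} :=
    measurableSet_le (by fun_prop) (by fun_prop)
  have h3 : MeasurableSet {z : ℝ × ℝ | QuadRegionLeft μ z.1 z.2} :=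
    MeasurableSet.inter (s₁ := {z : ℝ × ℝ | √(z.2 / z.1) < (1 - μ) / μ * (1 + (√z.1 + √z.2) ^ 2)})
      (s₂ := {z : ℝ × ℝ | z.2 < (μ - 1 / 2) * (1 + z.1 + z.2)})
      (measurableSet_lt (by fun_prop) (by fun_prop)) (measurableSet_lt (by fun_prop) (by fun_prop))
  unfold shareRight quadShare
  refine Measurable.ite h1 (by fun_prop) (Measurable.ite (h2.union h3) (by fun_prop) (by fun_prop))

/-! ### The rates of the three modes under the rule -/

/-- The rates into the relay queue of the three modes when the rule is followed. -/
def relayRate (P₁ P₂ μ : ℝ) (s : State) : Fin 3 → ℝ :=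
  ![Cap (P₁ * s.1), Cap (P₂ * s.1),
    ncRate (P₁ * s.2.1) (P₂ * s.2.2) (shareLeft μ (P₁ * s.2.1) (P₂ * s.2.2))
      (shareRight μ (P₁ * s.2.1) (P₂ * s.2.2))]

/-- The rates out of the relay queue of the three modes when the rule is followed. -/
def destRate (P₁ P₂ μ : ℝ) (s : State) : Fin 3 → ℝ :=
  ![Cap (P₁ * s.2.1), Cap (P₂ * s.2.2),
    coopRate (P₁ * s.2.1) (P₂ * s.2.2) (shareLeft μ (P₁ * s.2.1) (P₂ * s.2.2))
      (shareRight μ (P₁ * s.2.1) (P₂ * s.2.2))]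

/-- The selection metrics when the rule is followed. -/
def ruleMetric (P₁ P₂ μ : ℝ) (s : State) (k : Fin 3) : ℝ :=
  (1 - μ) * relayRate P₁ P₂ μ s k + μ * destRate P₁ P₂ μ s k

section

variable {P₁ P₂ μ : ℝ} {p : Protocol} {s : State}

lemma Protocol.FollowsRule.rates (h : p.FollowsRule P₁ P₂ μ) (hp : p.Admissible) (hP₁ : 0 < P₁)
    (hP₂ : 0 < P₂) (hμ : μ ∈ Icc (1 / 2 : ℝ) 1) (hs : s ∈ posStates) :
    ![p.C12c P₁ s, p.C21c P₂ s, p.Csumnc P₁ P₂ s] = relayRate P₁ P₂ μ s ∧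
      ![p.C1dc P₁ s, p.C2dc P₂ s, p.Csumc P₁ P₂ s] = destRate P₁ P₂ μ s := by
  obtain ⟨h1, h2, -, h3, h4, -⟩ := h.capacities hp hs
  obtain ⟨h5, h6⟩ := h.coop_eq hP₁ hP₂ hμ hs
  rw [h1, h2, h3, h4, hp.Csumnc_eq hs, Csumc_eq, h5, h6]
  exact ⟨rfl, rfl⟩

lemma metric_apply (k : Fin 3) : p.metric P₁ P₂ μ s k =
    (1 - μ) * ![p.C12c P₁ s, p.C21c P₂ s, p.Csumnc P₁ P₂ s] k +
      μ * ![p.C1dc P₁ s, p.C2dc P₂ s, p.Csumc P₁ P₂ s] k := by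
  fin_cases k <;> rfl

lemma Protocol.FollowsRule.metric_eq (h : p.FollowsRule P₁ P₂ μ) (hp : p.Admissible)
    (hP₁ : 0 < P₁) (hP₂ : 0 < P₂) (hμ : μ ∈ Icc (1 / 2 : ℝ) 1) (hs : s ∈ posStates) :
    p.metric P₁ P₂ μ s = ruleMetric P₁ P₂ μ s := by
  obtain ⟨h1, h2⟩ := h.rates hp hP₁ hP₂ hμ hs
  ext k
  rw [metric_apply, h1, h2, ruleMetric]

end

lemma measurable_ncRate : Measurable fun z : ℝ × ℝ × ℝ × ℝ => ncRate z.1 z.2.1 z.2.2.1 z.2.2.2 := by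
  unfold ncRate
  exact measurable_Cap.comp (by fun_prop)

lemma measurable_coopRate :
    Measurable fun z : ℝ × ℝ × ℝ × ℝ => coopRate z.1 z.2.1 z.2.2.1 z.2.2.2 := by
  unfold coopRate
  exact measurable_Cap.comp (by fun_prop)

lemma measurable_shareLeft_state (P₁ P₂ μ : ℝ) :
    Measurable fun s : State => shareLeft μ (P₁ * s.2.1) (P₂ * s.2.2) :=
  (measurable_shareLeft μ).comp (g := fun z : ℝ × ℝ => shareLeft μ z.1 z.2)
    (f := fun s : State => (P₁ * s.2.1, P₂ * s.2.2)) (by fun_prop)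

lemma measurable_shareRight_state (P₁ P₂ μ : ℝ) :
    Measurable fun s : State => shareRight μ (P₁ * s.2.1) (P₂ * s.2.2) :=
  (measurable_shareRight μ).comp (g := fun z : ℝ × ℝ => shareRight μ z.1 z.2)
    (f := fun s : State => (P₁ * s.2.1, P₂ * s.2.2)) (by fun_prop)

lemma measurable_relayRate (P₁ P₂ μ : ℝ) (k : Fin 3) :
    Measurable fun s => relayRate P₁ P₂ μ s k := by
  have hl := measurable_shareLeft_state P₁ P₂ μ
  have hr := measurable_shareRight_state P₁ P₂ μ
  have h0 : Measurable fun s : State => Cap (P₁ * s.1) := measurable_Cap.comp (by fun_prop)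
  have h1 : Measurable fun s : State => Cap (P₂ * s.1) := measurable_Cap.comp (by fun_prop)
  have hx : Measurable fun s : State => P₁ * s.2.1 := by fun_prop
  have hy : Measurable fun s : State => P₂ * s.2.2 := by fun_prop
  have h2 := measurable_ncRate.comp (hx.prodMk (hy.prodMk (hl.prodMk hr)))
  fin_cases k
  exacts [h0, h1, h2]

lemma measurable_destRate (P₁ P₂ μ : ℝ) (k : Fin 3) :
    Measurable fun s => destRate P₁ P₂ μ s k := by
  have hl := measurable_shareLeft_state P₁ P₂ μ
  have hr := measurable_shareRight_state P₁ P₂ μ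
  have h0 : Measurable fun s : State => Cap (P₁ * s.2.1) := measurable_Cap.comp (by fun_prop)
  have h1 : Measurable fun s : State => Cap (P₂ * s.2.2) := measurable_Cap.comp (by fun_prop)
  have hx : Measurable fun s : State => P₁ * s.2.1 := by fun_prop
  have hy : Measurable fun s : State => P₂ * s.2.2 := by fun_prop
  have h2 := measurable_coopRate.comp (hx.prodMk (hy.prodMk (hl.prodMk hr)))
  fin_cases k
  exacts [h0, h1, h2]

lemma measurable_ruleMetric (P₁ P₂ μ : ℝ) (k : Fin 3) :
    Measurable fun s => ruleMetric P₁ P₂ μ s k :=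
  ((measurable_relayRate P₁ P₂ μ k).const_mul _).add ((measurable_destRate P₁ P₂ μ k).const_mul _)

open Classical in
/-- A mode with the largest metric. -/
def ruleMode (P₁ P₂ μ : ℝ) (s : State) : Fin 3 :=
  if ruleMetric P₁ P₂ μ s 1 ≤ ruleMetric P₁ P₂ μ s 0 ∧
    ruleMetric P₁ P₂ μ s 2 ≤ ruleMetric P₁ P₂ μ s 0 then 0
  else if ruleMetric P₁ P₂ μ s 2 ≤ ruleMetric P₁ P₂ μ s 1 then 1 else 2

lemma ruleMetric_le_ruleMode (P₁ P₂ μ : ℝ) (s : State) (j : Fin 3) :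
    ruleMetric P₁ P₂ μ s j ≤ ruleMetric P₁ P₂ μ s (ruleMode P₁ P₂ μ s) := by
  unfold ruleMode
  split_ifs with h1 h2
  · fin_cases j
    exacts [le_rfl, h1.1, h1.2]
  · fin_cases j
    · by_contra! h
      exact h1 ⟨h.le, h2.trans h.le⟩
    exacts [le_rfl, h2]
  · push Not at h2
    fin_cases j
    · by_contra! h
      exact h1 ⟨(h2.trans h).le, h.le⟩
    exacts [h2.le, le_rfl]

lemma measurable_ruleMode (P₁ P₂ μ : ℝ) : Measurable (ruleMode P₁ P₂ μ) := by
  have h := measurable_ruleMetric P₁ P₂ μ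
  unfold ruleMode
  exact Measurable.ite ((measurableSet_le (h 1) (h 0)).inter (measurableSet_le (h 2) (h 0)))
    measurable_const (Measurable.ite (measurableSet_le (h 2) (h 1)) measurable_const
      measurable_const)

/-- A protocol which follows the rule. -/
def ruleProtocol (P₁ P₂ μ : ℝ) : Protocol where
  q k s := if ruleMode P₁ P₂ μ s = k then 1 else 0
  α₁ := ![fun _ => 1, fun _ => 0]
  β₂ := ![fun _ => 1, fun _ => 0]
  α₃ := ![fun s => shareLeft μ (P₁ * s.2.1) (P₂ * s.2.2), fun _ => 0,
    fun s => 1 - shareLeft μ (P₁ * s.2.1) (P₂ * s.2.2)]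
  β₃ := ![fun s => shareRight μ (P₁ * s.2.1) (P₂ * s.2.2), fun _ => 0,
    fun s => 1 - shareRight μ (P₁ * s.2.1) (P₂ * s.2.2)]

lemma isPowerSharing_one_zero :
    IsPowerSharing (![fun _ => 1, fun _ => 0] : Fin 2 → State → ℝ) := by
  refine ⟨fun j => ?_, fun s _ => ⟨fun j => ?_, by simp [Fin.sum_univ_two]⟩⟩
  · fin_cases j
    exacts [measurable_const, measurable_const]
  · fin_cases j <;> simp

lemma isPowerSharing_three {a : State → ℝ} (ha : Measurable a)
    (h : ∀ s ∈ posStates, a s ∈ Icc (0 : ℝ) 1) :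
    IsPowerSharing (![a, fun _ => 0, fun s => 1 - a s] : Fin 3 → State → ℝ) := by
  refine ⟨fun j => ?_, fun s hs => ⟨fun j => ?_, by simp [Fin.sum_univ_three]⟩⟩
  · fin_cases j
    exacts [ha, measurable_const, ha.const_sub 1]
  · have := h s hs
    fin_cases j
    · exact this
    · simp
    · exact ⟨sub_nonneg.2 this.2, sub_le_self _ this.1⟩

lemma admissible_ruleProtocol {P₁ P₂ μ : ℝ} (hP₁ : 0 < P₁) (hP₂ : 0 < P₂)
    (hμ : μ ∈ Icc (1 / 2 : ℝ) 1) : (ruleProtocol P₁ P₂ μ).Admissible where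
  q := by
    refine ⟨fun k => ?_, fun s _ => ⟨fun k => ?_, by simp [ruleProtocol]⟩⟩
    · exact Measurable.ite (measurable_ruleMode P₁ P₂ μ (measurableSet_singleton k))
        measurable_const measurable_const
    · by_cases h : ruleMode P₁ P₂ μ s = k <;> simp [ruleProtocol, h]
  α₁ := isPowerSharing_one_zero
  β₂ := isPowerSharing_one_zero
  α₃ := isPowerSharing_three (measurable_shareLeft_state P₁ P₂ μ) fun _ hs =>
    (isBestShare_share hμ (mul_pos hP₁ hs.2.1) (mul_pos hP₂ hs.2.2)).left
  β₃ := isPowerSharing_three (measurable_shareRight_state P₁ P₂ μ) fun _ hs =>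
    (isBestShare_share hμ (mul_pos hP₁ hs.2.1) (mul_pos hP₂ hs.2.2)).right

lemma ruleProtocol_rates (P₁ P₂ μ : ℝ) (s : State) :
    ![(ruleProtocol P₁ P₂ μ).C12c P₁ s, (ruleProtocol P₁ P₂ μ).C21c P₂ s,
        (ruleProtocol P₁ P₂ μ).Csumnc P₁ P₂ s] = relayRate P₁ P₂ μ s ∧
      ![(ruleProtocol P₁ P₂ μ).C1dc P₁ s, (ruleProtocol P₁ P₂ μ).C2dc P₂ s,
        (ruleProtocol P₁ P₂ μ).Csumc P₁ P₂ s] = destRate P₁ P₂ μ s := by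
  rw [Csumc_eq]
  simp [Protocol.C12c, Protocol.C1dc, Protocol.C21c, Protocol.C2dc, Protocol.Csumnc,
    ruleProtocol, relayRate, destRate, ncRate, Protocol.coop₁, Protocol.coop₂, mul_assoc]

lemma followsRule_ruleProtocol {P₁ P₂ μ : ℝ} (hP₁ : 0 < P₁) (hP₂ : 0 < P₂)
    (hμ : 1 / 2 ≤ μ) : (ruleProtocol P₁ P₂ μ).FollowsRule P₁ P₂ μ where
  mode s _ k hk j := by
    have hk' : ruleMode P₁ P₂ μ s = k := by
      by_contra h
      simp [ruleProtocol, h] at hk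
    obtain ⟨h1, h2⟩ := ruleProtocol_rates P₁ P₂ μ s
    rw [metric_apply, metric_apply, h1, h2, ← hk']
    exact ruleMetric_le_ruleMode P₁ P₂ μ s j
  α₁ _ _ := rfl
  β₂ _ _ := rfl
  α₃_full s hs h := (add_zero _).trans
    (shareLeft_of_full hμ (mul_pos hP₁ hs.2.1) (mul_pos hP₂ hs.2.2) h)
  α₃_quad s hs h := (add_zero _).trans
    (shareLeft_of_quad hμ (mul_pos hP₁ hs.2.1) (mul_pos hP₂ hs.2.2) h)
  α₃_lin s hs h := (add_zero _).trans (shareLeft_of_lin h)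
  β₃_full s hs h := (add_zero _).trans
    (shareRight_of_full hμ (mul_pos hP₁ hs.2.1) (mul_pos hP₂ hs.2.2) h)
  β₃_quad s hs h := (add_zero _).trans
    (shareRight_of_quad hμ (mul_pos hP₁ hs.2.1) (mul_pos hP₂ hs.2.2) h)
  β₃_lin s hs h := (add_zero _).trans (shareRight_of_lin h)

/-! ### Almost sure uniqueness of the best mode -/

lemma share_one {x y : ℝ} (hx : 0 < x) (hy : 0 < y) :
    shareLeft 1 x y = 1 ∧ shareRight 1 x y = 1 := by
  have h : FullRegion 1 x y := by simp [FullRegion]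
  exact ⟨shareLeft_of_full (by norm_num) hx hy (Or.inl h),
    shareRight_of_full (by norm_num) hx hy (Or.inl h)⟩

/-- At weight one the metrics no longer depend on `s₀`, so the slicing argument for ties is
unavailable; the strict gain from coherent combining in `M₃` replaces it. -/
lemma ruleMetric_one_lt {P₁ P₂ : ℝ} (hP₁ : 0 < P₁) (hP₂ : 0 < P₂) {s : State}
    (hs : s ∈ posStates) : ruleMetric P₁ P₂ 1 s 0 < ruleMetric P₁ P₂ 1 s 2 ∧
      ruleMetric P₁ P₂ 1 s 1 < ruleMetric P₁ P₂ 1 s 2 := by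
  have hx : 0 < P₁ * s.2.1 := mul_pos hP₁ hs.2.1
  have hy : 0 < P₂ * s.2.2 := mul_pos hP₂ hs.2.2
  obtain ⟨h1, h2⟩ := share_one hx hy
  have h0 : 0 ≤ √(1 * 1 * (P₁ * s.2.1 * (P₂ * s.2.2))) := Real.sqrt_nonneg _
  simp only [ruleMetric, destRate, h1, h2, coopRate, sub_self, zero_mul, zero_add, one_mul]
  exact ⟨Cap_lt hx.le (by simp only [one_mul] at h0; linarith),
    Cap_lt hy.le (by simp only [one_mul] at h0; linarith)⟩

/-- For each pair of modes, some gain enters one metric strictly monotonically and the other not at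
all: `s₂` separates `M₁` from `M₂`, and `s₀` separates either of them from `M₃` when `μ < 1`. A tie
therefore fixes that gain once the others are given. -/
lemma ae_injective_ruleMetric {P₁ P₂ μ : ℝ} (hP₁ : 0 < P₁) (hP₂ : 0 < P₂)
    (hμ : μ ∈ Icc (1 / 2 : ℝ) 1) {f₀ f₁ f₂ : ℝ → ℝ} (hf₀ : IsGainDensity f₀)
    (hf₁ : IsGainDensity f₁) (hf₂ : IsGainDensity f₂) :
    ∀ᵐ s ∂(fadingLaw f₀ f₁ f₂), Function.Injective (ruleMetric P₁ P₂ μ s) := by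
  have hm := measurable_ruleMetric P₁ P₂ μ
  have hμ0 : 0 < μ := by linarith [hμ.1]
  have hT : ∀ k j, MeasurableSet
      (posStates ∩ {s | ruleMetric P₁ P₂ μ s k = ruleMetric P₁ P₂ μ s j}) :=
    fun k j => measurableSet_posStates.inter (measurableSet_eq_fun (hm k) (hm j))
  have hcap : ∀ {P c t u : ℝ}, 0 < P → 0 < c → 0 < t → 0 < u →
      c * Cap (P * t) = c * Cap (P * u) → t = u := by
    intro P c t u hP hc ht hu h
    exact mul_left_cancel₀ hP.ne' (Cap_inj (by positivity) (by positivity)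
      (mul_left_cancel₀ hc.ne' h))
  have h01 := fadingLaw_null_of_slice_snd_snd hf₀ hf₁ hf₂ (hT 0 1) (by
    rintro t u v ⟨hv, e⟩ v' ⟨hv', e'⟩
    simp only [mem_ofPred_eq, ruleMetric, relayRate, destRate, Matrix.cons_val_zero,
      Matrix.cons_val_one] at e e'
    exact hcap hP₂ hμ0 hv.2.2 hv'.2.2 (by linarith))
  have h02 := fadingLaw_null_of_slice_fst hf₀ hf₁ hf₂ (hT 0 2) (by
    rintro r t ⟨ht, e⟩ t' ⟨ht', e'⟩
    rcases hμ.2.lt_or_eq with h1 | rfl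
    · simp only [mem_ofPred_eq, ruleMetric, relayRate, destRate, Matrix.cons_val_zero,
        Matrix.cons_val] at e e'
      exact hcap hP₁ (sub_pos.2 h1) ht.1 ht'.1 (by linarith)
    · exact absurd e (ruleMetric_one_lt hP₁ hP₂ ht).1.ne)
  have h12 := fadingLaw_null_of_slice_fst hf₀ hf₁ hf₂ (hT 1 2) (by
    rintro r t ⟨ht, e⟩ t' ⟨ht', e'⟩
    rcases hμ.2.lt_or_eq with h1 | rfl
    · simp only [mem_ofPred_eq, ruleMetric, relayRate, destRate, Matrix.cons_val_one,
        Matrix.cons_val] at e e'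
      exact hcap hP₂ (sub_pos.2 h1) ht.1 ht'.1 (by linarith)
    · exact absurd e (ruleMetric_one_lt hP₁ hP₂ ht).2.ne)
  filter_upwards [ae_mem_posStates hf₀ hf₁ hf₂, measure_eq_zero_iff_ae_notMem.1 h01,
    measure_eq_zero_iff_ae_notMem.1 h02, measure_eq_zero_iff_ae_notMem.1 h12] with s hs e1 e2 e3
  have e1' : ruleMetric P₁ P₂ μ s 0 ≠ ruleMetric P₁ P₂ μ s 1 := fun h => e1 ⟨hs, h⟩
  have e2' : ruleMetric P₁ P₂ μ s 0 ≠ ruleMetric P₁ P₂ μ s 2 := fun h => e2 ⟨hs, h⟩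
  have e3' : ruleMetric P₁ P₂ μ s 1 ≠ ruleMetric P₁ P₂ μ s 2 := fun h => e3 ⟨hs, h⟩
  intro i j hij
  fin_cases i <;> fin_cases j <;>
    first | rfl | exact absurd hij ‹_› | exact absurd hij.symm ‹_›

/-! ### Integrability of the rates -/

/-- An integrable bound for all instantaneous capacities. -/
def rateBound (P₁ P₂ : ℝ) (s : State) : ℝ := 4 * (P₁ + P₂) * (s.1 + s.2.1 + s.2.2)

lemma integrable_rateBound (P₁ P₂ : ℝ) {f₀ f₁ f₂ : ℝ → ℝ} (hf₀ : IsGainDensity f₀)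
    (hf₁ : IsGainDensity f₁) (hf₂ : IsGainDensity f₂) :
    Integrable (rateBound P₁ P₂) (fadingLaw f₀ f₁ f₂) := by
  obtain ⟨h0, h1, h2⟩ := integrable_gains hf₀ hf₁ hf₂
  exact ((h0.add h1).add h2).const_mul _

lemma integrable_of_le_rateBound {P₁ P₂ : ℝ} {f₀ f₁ f₂ : ℝ → ℝ} (hf₀ : IsGainDensity f₀)
    (hf₁ : IsGainDensity f₁) (hf₂ : IsGainDensity f₂) {g : State → ℝ} (hg : Measurable g)
    (hb : ∀ s ∈ posStates, |g s| ≤ rateBound P₁ P₂ s) : Integrable g (fadingLaw f₀ f₁ f₂) :=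
  (integrable_rateBound P₁ P₂ hf₀ hf₁ hf₂).mono' hg.aestronglyMeasurable
    ((ae_mem_posStates hf₀ hf₁ hf₂).mono fun s hs => hb s hs)

lemma Cap_div_one_add_le {a b z : ℝ} (hb : 0 ≤ b) (hab : a + b = 1) (hz : 0 ≤ z) :
    Cap (a * z / (1 + b * z)) ≤ Cap z := by
  rw [Cap_div_one_add hb hab hz]
  linarith [Cap_nonneg (mul_nonneg hb hz)]

lemma gains_le_rateBound {P₁ P₂ : ℝ} (hP₁ : 0 < P₁) (hP₂ : 0 < P₂) {s : State}
    (hs : s ∈ posStates) : 2 * (P₁ * s.1) ≤ rateBound P₁ P₂ s ∧ 2 * (P₂ * s.1) ≤ rateBound P₁ P₂ s ∧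
      2 * (2 * (P₁ * s.2.1 + P₂ * s.2.2)) ≤ rateBound P₁ P₂ s := by
  obtain ⟨h0, h1, h2⟩ := hs
  have a0 := mul_pos hP₁ h0
  have a1 := mul_pos hP₁ h1
  have a2 := mul_pos hP₁ h2
  have b0 := mul_pos hP₂ h0
  have b1 := mul_pos hP₂ h1
  have b2 := mul_pos hP₂ h2
  unfold rateBound
  refine ⟨?_, ?_, ?_⟩ <;> nlinarith

lemma ncRate_le {x y a b : ℝ} (hx : 0 < x) (hy : 0 < y) (ha : a ∈ Icc (0 : ℝ) 1)
    (hb : b ∈ Icc (0 : ℝ) 1) : 0 ≤ ncRate x y a b ∧ ncRate x y a b ≤ 2 * (2 * (x + y)) := by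
  have h := ncArg_nonneg hx.le hy.le ha hb
  refine ⟨Cap_nonneg h, (Cap_le_two_mul h).trans ?_⟩
  have := mul_nonneg ha.1 hx.le
  have := mul_nonneg hb.1 hy.le
  linarith

lemma coopRate_le {x y a b : ℝ} (hx : 0 < x) (hy : 0 < y) (ha : a ∈ Icc (0 : ℝ) 1)
    (hb : b ∈ Icc (0 : ℝ) 1) : 0 ≤ coopRate x y a b ∧ coopRate x y a b ≤ 2 * (2 * (x + y)) := by
  have h : 0 ≤ x + y + 2 * √(a * b * (x * y)) := by positivity
  refine ⟨Cap_nonneg h, (Cap_le_two_mul h).trans ?_⟩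
  have hab : a * b * (x * y) ≤ x * y :=
    mul_le_of_le_one_left (by positivity) (mul_le_one₀ ha.2 hb.1 hb.2)
  have : √(a * b * (x * y)) ≤ (x + y) / 2 :=
    Real.sqrt_le_iff.2 ⟨by positivity, by nlinarith [sq_nonneg (x - y)]⟩
  linarith

namespace Protocol

lemma Admissible.mode_mem {p : Protocol} (hp : p.Admissible) {s : State} (hs : s ∈ posStates)
    (k : Fin 3) : |p.q k s| ≤ 1 := by
  rcases (hp.q.2 s hs).1 k with h | h <;> simp [h]

section Rates

variable {P₁ P₂ : ℝ} {p : Protocol}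

lemma Admissible.measurable_rates (hp : p.Admissible) (P₁ P₂ : ℝ) :
    (Measurable (p.C12c P₁) ∧ Measurable (p.C1dc P₁) ∧ Measurable (p.C1dnc P₁)) ∧
    (Measurable (p.C21c P₂) ∧ Measurable (p.C2dc P₂) ∧ Measurable (p.C2dnc P₂)) ∧
    Measurable (p.Csumnc P₁ P₂) ∧ Measurable (p.Csumc P₁ P₂) := by
  have a0 := hp.α₁.1 0
  have a1 := hp.α₁.1 1
  have b0 := hp.β₂.1 0
  have b1 := hp.β₂.1 1
  have c0 := hp.α₃.1 0
  have c1 := hp.α₃.1 1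
  have c2 := hp.α₃.1 2
  have d0 := hp.β₃.1 0
  have d1 := hp.β₃.1 1
  have d2 := hp.β₃.1 2
  refine ⟨⟨?_, ?_, ?_⟩, ⟨?_, ?_, ?_⟩, ?_, ?_⟩ <;> exact measurable_Cap.comp (by fun_prop)

lemma Admissible.abs_rates_le (hp : p.Admissible) (hP₁ : 0 < P₁) (hP₂ : 0 < P₂) {s : State}
    (hs : s ∈ posStates) :
    (|p.C12c P₁ s| ≤ rateBound P₁ P₂ s ∧ |p.C1dc P₁ s| ≤ rateBound P₁ P₂ s ∧
      |p.C1dnc P₁ s| ≤ rateBound P₁ P₂ s) ∧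
    (|p.C21c P₂ s| ≤ rateBound P₁ P₂ s ∧ |p.C2dc P₂ s| ≤ rateBound P₁ P₂ s ∧
      |p.C2dnc P₂ s| ≤ rateBound P₁ P₂ s) ∧
    |p.Csumnc P₁ P₂ s| ≤ rateBound P₁ P₂ s ∧ |p.Csumc P₁ P₂ s| ≤ rateBound P₁ P₂ s := by
  obtain ⟨g1, g2, g3⟩ := gains_le_rateBound hP₁ hP₂ hs
  obtain ⟨a0, a1, a⟩ := hp.α₁.two hs
  obtain ⟨b0, b1, b⟩ := hp.β₂.two hs
  have x0 := mul_pos hP₁ hs.1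
  have x1 := mul_pos hP₁ hs.2.1
  have y0 := mul_pos hP₂ hs.1
  have y2 := mul_pos hP₂ hs.2.2
  have hratio : ∀ {a b z : ℝ}, 0 ≤ a → 0 ≤ b → a + b = 1 → 0 < z →
      |Cap (a * z / (1 + b * z))| ≤ 2 * z := fun ha hb hab hz => by
    rw [abs_of_nonneg (Cap_nonneg (by positivity))]
    exact (Cap_div_one_add_le hb hab hz.le).trans (Cap_le_two_mul hz.le)
  have hmul : ∀ {a b z : ℝ}, 0 ≤ a → 0 ≤ b → a + b = 1 → 0 < z →
      |Cap (b * z)| ≤ 2 * z := fun ha hb hab hz => by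
    rw [abs_of_nonneg (Cap_nonneg (by positivity))]
    refine (Cap_le_two_mul (by positivity)).trans ?_
    nlinarith
  rw [hp.Csumnc_eq hs, Csumc_eq]
  obtain ⟨n1, n2⟩ := ncRate_le x1 y2 (hp.α₃.three hs).1 (hp.β₃.three hs).1
  obtain ⟨n3, n4⟩ := coopRate_le x1 y2 (hp.α₃.three hs).1 (hp.β₃.three hs).1
  refine ⟨⟨?_, ?_, ?_⟩, ⟨?_, ?_, ?_⟩, ?_, ?_⟩
  · simp only [C12c, mul_assoc]; linarith [hratio a0 a1 a x0]
  · simp only [C1dc, mul_assoc]; linarith [hratio a0 a1 a x1]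
  · simp only [C1dnc, mul_assoc]; linarith [hmul a0 a1 a x1]
  · simp only [C21c, mul_assoc]; linarith [hratio b0 b1 b y0]
  · simp only [C2dc, mul_assoc]; linarith [hratio b0 b1 b y2]
  · simp only [C2dnc, mul_assoc]; linarith [hmul b0 b1 b y2]
  · unfold coop₁ coop₂; rw [abs_of_nonneg n1]; linarith
  · unfold coop₁ coop₂; rw [abs_of_nonneg n3]; linarith

variable {f₀ f₁ f₂ : ℝ → ℝ}

lemma Admissible.integrable_mode_mul (hp : p.Admissible) (hf₀ : IsGainDensity f₀)
    (hf₁ : IsGainDensity f₁) (hf₂ : IsGainDensity f₂) (k : Fin 3) {c : State → ℝ}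
    (hc : Measurable c) (hb : ∀ s ∈ posStates, |c s| ≤ rateBound P₁ P₂ s) :
    Integrable (fun s => p.q k s * c s) (fadingLaw f₀ f₁ f₂) := by
  refine integrable_of_le_rateBound (P₁ := P₁) (P₂ := P₂) hf₀ hf₁ hf₂ ((hp.q.1 k).mul hc) fun s hs => ?_
  rw [abs_mul]
  exact (mul_le_of_le_one_left (abs_nonneg _) (hp.mode_mem hs k)).trans (hb s hs)

lemma Admissible.integrable_mode_mul_rates (hp : p.Admissible) (hP₁ : 0 < P₁) (hP₂ : 0 < P₂)
    (hf₀ : IsGainDensity f₀) (hf₁ : IsGainDensity f₁) (hf₂ : IsGainDensity f₂) :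
    (Integrable (fun s => p.q 0 s * p.C12c P₁ s) (fadingLaw f₀ f₁ f₂) ∧
      Integrable (fun s => p.q 0 s * p.C1dc P₁ s) (fadingLaw f₀ f₁ f₂) ∧
      Integrable (fun s => p.q 0 s * p.C1dnc P₁ s) (fadingLaw f₀ f₁ f₂)) ∧
    (Integrable (fun s => p.q 1 s * p.C21c P₂ s) (fadingLaw f₀ f₁ f₂) ∧
      Integrable (fun s => p.q 1 s * p.C2dc P₂ s) (fadingLaw f₀ f₁ f₂) ∧
      Integrable (fun s => p.q 1 s * p.C2dnc P₂ s) (fadingLaw f₀ f₁ f₂)) ∧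
    Integrable (fun s => p.q 2 s * p.Csumnc P₁ P₂ s) (fadingLaw f₀ f₁ f₂) ∧
    Integrable (fun s => p.q 2 s * p.Csumc P₁ P₂ s) (fadingLaw f₀ f₁ f₂) := by
  obtain ⟨⟨m1, m2, m3⟩, ⟨m4, m5, m6⟩, m7, m8⟩ := hp.measurable_rates P₁ P₂
  have b := fun s hs => hp.abs_rates_le hP₁ hP₂ (s := s) hs
  have I := fun k c hc hb => hp.integrable_mode_mul (P₁ := P₁) (P₂ := P₂) hf₀ hf₁ hf₂ k (c := c) hc hb
  exact ⟨⟨I 0 _ m1 fun s hs => (b s hs).1.1, I 0 _ m2 fun s hs => (b s hs).1.2.1,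
      I 0 _ m3 fun s hs => (b s hs).1.2.2⟩,
    ⟨I 1 _ m4 fun s hs => (b s hs).2.1.1, I 1 _ m5 fun s hs => (b s hs).2.1.2.1,
      I 1 _ m6 fun s hs => (b s hs).2.1.2.2⟩,
    I 2 _ m7 fun s hs => (b s hs).2.2.1, I 2 _ m8 fun s hs => (b s hs).2.2.2⟩

/-! ### The Lagrangian and the balance equation -/

/-- The integrand of the Lagrangian of the sum-rate problem. -/
def lagrangian (P₁ P₂ μ : ℝ) (p : Protocol) (s : State) : ℝ :=
  ∑ k, p.q k s * (p.metric P₁ P₂ μ s k + ![p.C1dnc P₁ s, p.C2dnc P₂ s, 0] k)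

lemma lagrangian_eq (μ : ℝ) (s : State) : p.lagrangian P₁ P₂ μ s =
    ((1 - μ) * (p.q 0 s * p.C12c P₁ s) + μ * (p.q 0 s * p.C1dc P₁ s) + p.q 0 s * p.C1dnc P₁ s) +
    ((1 - μ) * (p.q 1 s * p.C21c P₂ s) + μ * (p.q 1 s * p.C2dc P₂ s) + p.q 1 s * p.C2dnc P₂ s) +
    ((1 - μ) * (p.q 2 s * p.Csumnc P₁ P₂ s) + μ * (p.q 2 s * p.Csumc P₁ P₂ s)) := by
  simp only [lagrangian, Fin.sum_univ_three, metric, Matrix.cons_val_zero, Matrix.cons_val_one,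
    Matrix.cons_val]
  ring

/-- The Lagrangian is the sum-rate integrand minus `μ` times the inflow less the outflow of the
queue, and the mean of this penalty vanishes under balance. -/
lemma Admissible.integral_lagrangian (hp : p.Admissible) (hP₁ : 0 < P₁) (hP₂ : 0 < P₂)
    (hf₀ : IsGainDensity f₀) (hf₁ : IsGainDensity f₁) (hf₂ : IsGainDensity f₂) (μ : ℝ) :
    Integrable (p.lagrangian P₁ P₂ μ) (fadingLaw f₀ f₁ f₂) ∧
    (p.QueueBalance (fadingLaw f₀ f₁ f₂) P₁ P₂ →
      ∫ s, p.lagrangian P₁ P₂ μ s ∂(fadingLaw f₀ f₁ f₂)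
        = p.sumRate (fadingLaw f₀ f₁ f₂) P₁ P₂) := by
  obtain ⟨⟨m1, m2, m3⟩, ⟨m4, m5, m6⟩, m7, m8⟩ :=
    hp.integrable_mode_mul_rates hP₁ hP₂ hf₀ hf₁ hf₂
  have e : p.lagrangian P₁ P₂ μ = _ := funext (lagrangian_eq μ)
  have i1 := (m1.const_mul (1 - μ)).add (m2.const_mul μ)
  have i2 := (m4.const_mul (1 - μ)).add (m5.const_mul μ)
  have i3 := (m7.const_mul (1 - μ)).add (m8.const_mul μ)
  have j1 := i1.add m3
  have j2 := i2.add m6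
  have j := j1.add j2
  refine ⟨e ▸ j.add i3, fun hbal => ?_⟩
  simp only [Pi.add_def] at i1 i2 i3 j1 j2 j
  simp only [lagrangian_eq]
  rw [integral_add j i3, integral_add j1 j2,
    integral_add i1 m3, integral_add i2 m6, integral_add (m1.const_mul _) (m2.const_mul _),
    integral_add (m4.const_mul _) (m5.const_mul _), integral_add (m7.const_mul _) (m8.const_mul _)]
  simp only [integral_const_mul]
  simp only [QueueBalance, sumRate, avg] at hbal ⊢
  linear_combination (-μ) * hbal

lemma Admissible.queueBalance_iff (hp : p.Admissible) (hP₁ : 0 < P₁) (hP₂ : 0 < P₂)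
    (hf₀ : IsGainDensity f₀) (hf₁ : IsGainDensity f₁) (hf₂ : IsGainDensity f₂) :
    p.BalanceEquation (fadingLaw f₀ f₁ f₂) P₁ P₂ ↔
      p.QueueBalance (fadingLaw f₀ f₁ f₂) P₁ P₂ := by
  obtain ⟨⟨m1, m2, -⟩, ⟨m4, m5, -⟩, m7, m8⟩ :=
    hp.integrable_mode_mul_rates hP₁ hP₂ hf₀ hf₁ hf₂
  have i1 := m1.sub m2
  have i2 := m4.sub m5
  have i3 := m7.sub m8
  have j := i1.add i2
  simp only [Pi.add_def, Pi.sub_def] at i1 i2 i3 j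
  unfold BalanceEquation QueueBalance avg
  simp only [mul_sub]
  rw [integral_add j i3, integral_add i1 i2,
    integral_sub m1 m2, integral_sub m4 m5, integral_sub m7 m8]
  constructor <;> intro h <;> linarith

end Rates

end Protocol

/-! ### Optimality -/

lemma coopRate_zero (x y : ℝ) : coopRate x y 0 0 = Cap (x + y) := by simp [coopRate]

lemma ncRate_zero (x y : ℝ) : ncRate x y 0 0 = Cap (x + y) := by simp [ncRate]

/-- Without cooperation both rates of `M₃` equal the same capacity, so the weights drop out. This is
how `M₃` dominates direct transmission by a single station. -/
lemma Cap_add_le_ruleMetric {P₁ P₂ μ : ℝ} (hP₁ : 0 < P₁) (hP₂ : 0 < P₂)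
    (hμ : μ ∈ Icc (1 / 2 : ℝ) 1) {s : State} (hs : s ∈ posStates) :
    Cap (P₁ * s.2.1 + P₂ * s.2.2) ≤ ruleMetric P₁ P₂ μ s 2 := by
  have h := (isBestShare_share hμ (mul_pos hP₁ hs.2.1) (mul_pos hP₂ hs.2.2)).le 0 (by simp) 0
    (by simp)
  rw [ncRate_zero, coopRate_zero] at h
  calc _ = (1 - μ) * Cap (P₁ * s.2.1 + P₂ * s.2.2) + μ * Cap (P₁ * s.2.1 + P₂ * s.2.2) := by ring
    _ ≤ _ := h

/-- Splitting the power of a base station in mode `M₁` or `M₂` is never better than either using it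
for the cooperative codeword, or transmitting directly. -/
lemma split_le {μ a b z w : ℝ} (hμ : μ ≤ 1) (ha : 0 ≤ a) (hb : 0 ≤ b) (hab : a + b = 1)
    (hz : 0 < z) (hw : 0 < w) :
    (1 - μ) * Cap (a * z / (1 + b * z)) + μ * Cap (a * w / (1 + b * w)) + Cap (b * w)
      ≤ max ((1 - μ) * Cap z + μ * Cap w) (Cap w) := by
  rw [Cap_div_one_add hb hab hw.le]
  -- If the link between the base stations is the stronger one, the power of the direct codeword is
  -- better moved to the cooperative one. Otherwise the cooperative codeword carries no more than it
  -- would directly to the macro BS, so direct transmission is at least as good.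
  rcases le_total w z with h | h
  · refine le_max_of_le_left ?_
    rw [Cap_div_one_add hb hab hz.le]
    have := mul_le_mul_of_nonneg_left (Cap_le (show 0 ≤ b * w by positivity)
      (mul_le_mul_of_nonneg_left h hb)) (sub_nonneg.2 hμ)
    linarith
  · refine le_max_of_le_right ?_
    have hle : Cap (a * z / (1 + b * z)) ≤ Cap w - Cap (b * w) := by
      rw [← Cap_div_one_add hb hab hw.le]
      refine Cap_le (by positivity) ?_
      rw [div_le_div_iff₀ (by positivity) (by positivity)]
      nlinarith [mul_le_mul_of_nonneg_left h ha]
    have := mul_le_mul_of_nonneg_left hle (sub_nonneg.2 hμ)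
    linarith

lemma Protocol.Admissible.lagrangian_le {P₁ P₂ μ : ℝ} {p : Protocol} (hp : p.Admissible)
    (hP₁ : 0 < P₁) (hP₂ : 0 < P₂) (hμ : μ ∈ Icc (1 / 2 : ℝ) 1) {s : State} (hs : s ∈ posStates)
    {v : ℝ} (hv : ∀ k, ruleMetric P₁ P₂ μ s k ≤ v) : p.lagrangian P₁ P₂ μ s ≤ v := by
  have x1 := mul_pos hP₁ hs.2.1
  have y2 := mul_pos hP₂ hs.2.2
  have hcap := (Cap_add_le_ruleMetric hP₁ hP₂ hμ hs).trans (hv 2)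
  have hcx : Cap (P₁ * s.2.1) ≤ v := (Cap_le x1.le (by linarith)).trans hcap
  have hcy : Cap (P₂ * s.2.2) ≤ v := (Cap_le y2.le (by linarith)).trans hcap
  have key : ∀ k, p.metric P₁ P₂ μ s k + ![p.C1dnc P₁ s, p.C2dnc P₂ s, 0] k ≤ v := by
    intro k
    fin_cases k
    · obtain ⟨a0, a1, a⟩ := hp.α₁.two hs
      have h := split_le hμ.2 a0 a1 a (mul_pos hP₁ hs.1) x1
      refine le_trans (le_of_eq ?_) (h.trans (max_le (hv 0) hcx))
      simp [Protocol.metric, Protocol.C12c, Protocol.C1dc, Protocol.C1dnc, mul_assoc]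
    · obtain ⟨b0, b1, b⟩ := hp.β₂.two hs
      have h := split_le hμ.2 b0 b1 b (mul_pos hP₂ hs.1) y2
      refine le_trans (le_of_eq ?_) (h.trans (max_le (hv 1) hcy))
      simp [Protocol.metric, Protocol.C21c, Protocol.C2dc, Protocol.C2dnc, mul_assoc]
    · have h := (isBestShare_share hμ x1 y2).le _ (hp.α₃.three hs).1 _ (hp.β₃.three hs).1
      refine le_trans (le_of_eq ?_) (h.trans (hv 2))
      simp [Protocol.metric, hp.Csumnc_eq hs, Csumc_eq, Protocol.coop₁, Protocol.coop₂]
  obtain ⟨k, hk, hj⟩ := hp.q.exists_mode hs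
  rw [Protocol.lagrangian, Finset.sum_eq_single k (fun j _ hjk => by rw [hj j hjk, zero_mul])
    (by simp), hk, one_mul]
  exact key k

lemma Protocol.FollowsRule.le_lagrangian {P₁ P₂ μ : ℝ} {p : Protocol}
    (h : p.FollowsRule P₁ P₂ μ) (hp : p.Admissible)
    (hP₁ : 0 < P₁) (hP₂ : 0 < P₂) (hμ : μ ∈ Icc (1 / 2 : ℝ) 1) {s : State} (hs : s ∈ posStates)
    (j : Fin 3) : ruleMetric P₁ P₂ μ s j ≤ p.lagrangian P₁ P₂ μ s := by
  obtain ⟨k, hk, hj⟩ := hp.q.exists_mode hs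
  obtain ⟨-, -, h1, -, -, h2⟩ := h.capacities hp hs
  have h0 : ![p.C1dnc P₁ s, p.C2dnc P₂ s, 0] k = 0 := by fin_cases k <;> simp [h1, h2]
  rw [Protocol.lagrangian, Finset.sum_eq_single k (fun j _ hjk => by rw [hj j hjk, zero_mul])
    (by simp), hk, one_mul, h0, add_zero, ← h.metric_eq hp hP₁ hP₂ hμ hs]
  exact h.mode s hs k hk j

lemma Protocol.FollowsRule.isOptimal {P₁ P₂ μ : ℝ} {p : Protocol}
    (h : p.FollowsRule P₁ P₂ μ) (hp : p.Admissible)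
    (hP₁ : 0 < P₁) (hP₂ : 0 < P₂) (hμ : μ ∈ Icc (1 / 2 : ℝ) 1) {f₀ f₁ f₂ : ℝ → ℝ}
    (hf₀ : IsGainDensity f₀) (hf₁ : IsGainDensity f₁) (hf₂ : IsGainDensity f₂)
    (hbal : p.BalanceEquation (fadingLaw f₀ f₁ f₂) P₁ P₂) :
    p.IsOptimal (fadingLaw f₀ f₁ f₂) P₁ P₂ := by
  rw [hp.queueBalance_iff hP₁ hP₂ hf₀ hf₁ hf₂] at hbal
  refine ⟨⟨hp, hbal⟩, fun p' hp' => ?_⟩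
  obtain ⟨i, e⟩ := hp.integral_lagrangian hP₁ hP₂ hf₀ hf₁ hf₂ μ
  obtain ⟨i', e'⟩ := hp'.1.integral_lagrangian hP₁ hP₂ hf₀ hf₁ hf₂ μ
  change p'.sumRate (fadingLaw f₀ f₁ f₂) P₁ P₂ ≤ p.sumRate (fadingLaw f₀ f₁ f₂) P₁ P₂
  rw [← e hbal, ← e' hp'.2]
  refine integral_mono_ae i' i ((ae_mem_posStates hf₀ hf₁ hf₂).mono fun s hs => ?_)
  exact hp'.1.lagrangian_le hP₁ hP₂ hμ hs fun k => h.le_lagrangian hp hP₁ hP₂ hμ hs k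

/-! ### The mean drift of the relay queue as a function of the weight -/

/-- A unique maximizer over a compact set depends continuously on the weight. -/
lemma continuousWithinAt_argmax {K : Set (ℝ × ℝ)} (hK : IsCompact K) {I : Set ℝ} {z : ℝ → ℝ × ℝ}
    {μ₀ : ℝ} (hμ₀ : μ₀ ∈ I) (hz : ∀ μ ∈ I, z μ ∈ K)
    (hmax : ∀ μ ∈ I, ∀ w ∈ K, (1 - μ) * w.1 + μ * w.2 ≤ (1 - μ) * (z μ).1 + μ * (z μ).2)
    (huniq : ∀ w ∈ K, (1 - μ₀) * (z μ₀).1 + μ₀ * (z μ₀).2 ≤ (1 - μ₀) * w.1 + μ₀ * w.2 →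
      w = z μ₀) : ContinuousWithinAt z I μ₀ := by
  -- Along any ultrafilter, compactness gives the values a limit in `K`; the maximality inequalities
  -- pass to the limit, and uniqueness identifies it with `z μ₀`.
  refine (Filter.tendsto_iff_ultrafilter _ _ _).2 fun U hU => ?_
  have hI : ∀ᶠ μ in (U : Filter ℝ), μ ∈ I := hU self_mem_nhdsWithin
  have hid : Filter.Tendsto id (U : Filter ℝ) (nhds μ₀) := hU.trans nhdsWithin_le_nhds
  obtain ⟨k, hk, hlim⟩ := hK.ultrafilter_le_nhds (U.map z)
    (Filter.le_principal_iff.2 (hI.mono fun μ hμ => hz μ hμ))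
  have hlim' : Filter.Tendsto z (U : Filter ℝ) (nhds k) := hlim
  have h1 : Filter.Tendsto (fun μ => (1 - μ) * (z μ₀).1 + μ * (z μ₀).2) (U : Filter ℝ)
      (nhds ((1 - μ₀) * (z μ₀).1 + μ₀ * (z μ₀).2)) :=
    ((hid.const_sub 1).mul_const _).add (hid.mul_const _)
  have h2 : Filter.Tendsto (fun μ => (1 - μ) * (z μ).1 + μ * (z μ).2) (U : Filter ℝ)
      (nhds ((1 - μ₀) * k.1 + μ₀ * k.2)) :=
    ((hid.const_sub 1).mul ((continuous_fst.tendsto k).comp hlim')).add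
      (hid.mul ((continuous_snd.tendsto k).comp hlim'))
  have hle := le_of_tendsto_of_tendsto h1 h2
    (hI.mono fun μ hμ => hmax μ hμ (z μ₀) (hz μ₀ hμ₀))
  exact huniq k hk hle ▸ hlim'

/-- The rate pairs which can be achieved in a state. -/
def ratePairs (P₁ P₂ : ℝ) (s : State) : Set (ℝ × ℝ) :=
  {(Cap (P₁ * s.1), Cap (P₁ * s.2.1)), (Cap (P₂ * s.1), Cap (P₂ * s.2.2))} ∪
    (fun c : ℝ × ℝ => (ncRate (P₁ * s.2.1) (P₂ * s.2.2) c.1 c.2,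
      coopRate (P₁ * s.2.1) (P₂ * s.2.2) c.1 c.2)) '' (Icc 0 1 ×ˢ Icc 0 1)

lemma isCompact_ratePairs {P₁ P₂ : ℝ} (hP₁ : 0 < P₁) (hP₂ : 0 < P₂) {s : State}
    (hs : s ∈ posStates) : IsCompact (ratePairs P₁ P₂ s) := by
  have x1 := mul_pos hP₁ hs.2.1
  have y2 := mul_pos hP₂ hs.2.2
  refine IsCompact.union (Set.toFinite _).isCompact ?_
  refine (isCompact_Icc.prod isCompact_Icc).image_of_continuousOn ?_
  unfold ncRate coopRate
  refine ContinuousOn.prodMk ?_ ?_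
  · exact continuousOn_Cap.comp (by fun_prop) fun c hc => ncArg_nonneg x1.le y2.le hc.1 hc.2
  · refine continuousOn_Cap.comp (by fun_prop) fun c _ => ?_
    rw [mem_Ici]
    positivity

/-- The change of the relay queue when the rule is followed. -/
def ruleDrift (P₁ P₂ μ : ℝ) (s : State) : ℝ :=
  relayRate P₁ P₂ μ s (ruleMode P₁ P₂ μ s) - destRate P₁ P₂ μ s (ruleMode P₁ P₂ μ s)

lemma measurable_ruleDrift (P₁ P₂ μ : ℝ) : Measurable (ruleDrift P₁ P₂ μ) := by
  have e : ruleDrift P₁ P₂ μ = fun s => ∑ k, (if ruleMode P₁ P₂ μ s = k then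
      relayRate P₁ P₂ μ s k - destRate P₁ P₂ μ s k else 0) := by
    ext s; simp [ruleDrift]
  rw [e]
  exact Finset.measurable_sum _ fun k _ =>
    Measurable.ite (measurable_ruleMode P₁ P₂ μ (measurableSet_singleton k))
      ((measurable_relayRate P₁ P₂ μ k).sub (measurable_destRate P₁ P₂ μ k)) measurable_const

lemma abs_ruleDrift_le {P₁ P₂ μ : ℝ} (hP₁ : 0 < P₁) (hP₂ : 0 < P₂)
    (hμ : μ ∈ Icc (1 / 2 : ℝ) 1) {s : State} (hs : s ∈ posStates) :
    |ruleDrift P₁ P₂ μ s| ≤ rateBound P₁ P₂ s := by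
  obtain ⟨g1, g2, g3⟩ := gains_le_rateBound hP₁ hP₂ hs
  have x0 := mul_pos hP₁ hs.1
  have x1 := mul_pos hP₁ hs.2.1
  have y0 := mul_pos hP₂ hs.1
  have y2 := mul_pos hP₂ hs.2.2
  have hb := isBestShare_share hμ x1 y2
  have hcap : ∀ {z : ℝ}, 0 < z → 2 * z ≤ rateBound P₁ P₂ s →
      0 ≤ Cap z ∧ Cap z ≤ rateBound P₁ P₂ s :=
    fun hz h => ⟨Cap_nonneg hz.le, (Cap_le_two_mul hz.le).trans h⟩
  have h1 : ∀ k, 0 ≤ relayRate P₁ P₂ μ s k ∧ relayRate P₁ P₂ μ s k ≤ rateBound P₁ P₂ s := by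
    intro k
    fin_cases k
    · exact hcap x0 g1
    · exact hcap y0 g2
    · exact ⟨(ncRate_le x1 y2 hb.left hb.right).1, (ncRate_le x1 y2 hb.left hb.right).2.trans g3⟩
  have h2 : ∀ k, 0 ≤ destRate P₁ P₂ μ s k ∧ destRate P₁ P₂ μ s k ≤ rateBound P₁ P₂ s := by
    intro k
    fin_cases k
    · exact hcap x1 (by linarith)
    · exact hcap y2 (by linarith)
    · exact ⟨(coopRate_le x1 y2 hb.left hb.right).1,
        (coopRate_le x1 y2 hb.left hb.right).2.trans g3⟩
  have a := h1 (ruleMode P₁ P₂ μ s)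
  have b := h2 (ruleMode P₁ P₂ μ s)
  rw [ruleDrift, abs_le]
  constructor <;> linarith

/-- The mode may jump as `μ` varies, but the selected rate pair always maximizes a linear functional
over `ratePairs`, a compact set independent of `μ`. Uniqueness at `μ₀` comes from distinct metrics
between modes and from `IsBestShare.unique` within `M₃`, so no continuity of the share formulas is
required. -/
lemma continuousWithinAt_ruleDrift {P₁ P₂ μ₀ : ℝ} (hP₁ : 0 < P₁) (hP₂ : 0 < P₂)
    (hμ₀ : μ₀ ∈ Icc (1 / 2 : ℝ) 1) {s : State} (hs : s ∈ posStates)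
    (hinj : Function.Injective (ruleMetric P₁ P₂ μ₀ s)) :
    ContinuousWithinAt (fun μ => ruleDrift P₁ P₂ μ s) (Icc (1 / 2) 1) μ₀ := by
  have x1 := mul_pos hP₁ hs.2.1
  have y2 := mul_pos hP₂ hs.2.2
  set z : ℝ → ℝ × ℝ := fun μ => (relayRate P₁ P₂ μ s (ruleMode P₁ P₂ μ s),
    destRate P₁ P₂ μ s (ruleMode P₁ P₂ μ s)) with hzdef
  have hmem : ∀ μ ∈ Icc (1 / 2 : ℝ) 1, ∀ k,
      (relayRate P₁ P₂ μ s k, destRate P₁ P₂ μ s k) ∈ ratePairs P₁ P₂ s := by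
    intro μ hμ k
    have hb := isBestShare_share hμ x1 y2
    fin_cases k
    · exact Or.inl (Or.inl rfl)
    · exact Or.inl (Or.inr rfl)
    · exact Or.inr ⟨(_, _), ⟨hb.left, hb.right⟩, rfl⟩
  have hz : ContinuousWithinAt z (Icc (1 / 2) 1) μ₀ := by
    refine continuousWithinAt_argmax (isCompact_ratePairs hP₁ hP₂ hs) hμ₀
      (fun μ hμ => hmem μ hμ _) ?_ ?_
    · intro μ hμ w hw
      have hle := ruleMetric_le_ruleMode P₁ P₂ μ s
      change _ ≤ ruleMetric P₁ P₂ μ s (ruleMode P₁ P₂ μ s)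
      rcases hw with (rfl | rfl) | ⟨c, hc, rfl⟩
      · exact hle 0
      · exact hle 1
      · exact ((isBestShare_share hμ x1 y2).le _ hc.1 _ hc.2).trans (hle 2)
    · intro w hw hwle
      have hle := ruleMetric_le_ruleMode P₁ P₂ μ₀ s
      change ruleMetric P₁ P₂ μ₀ s (ruleMode P₁ P₂ μ₀ s) ≤ _ at hwle
      have hmode : ∀ k, ruleMetric P₁ P₂ μ₀ s (ruleMode P₁ P₂ μ₀ s) ≤ ruleMetric P₁ P₂ μ₀ s k →
          ruleMode P₁ P₂ μ₀ s = k := fun k hk => hinj (le_antisymm hk (hle k))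
      rcases hw with (rfl | rfl) | ⟨c, hc, rfl⟩
      · have h := hmode 0 hwle
        rw [hzdef]; simp only [h]; rfl
      · have h := hmode 1 hwle
        rw [hzdef]; simp only [h]; rfl
      · have hb := isBestShare_share hμ₀ x1 y2
        have h := hmode 2 (hwle.trans (hb.le _ hc.1 _ hc.2))
        obtain ⟨e1, e2⟩ := hb.unique _ hc.1 _ hc.2 ((hle 2).trans hwle)
        rw [hzdef]; simp only [h, e1, e2]; rfl
  exact (continuous_fst.sub continuous_snd).continuousAt.comp_continuousWithinAt hz

section Law

variable {P₁ P₂ : ℝ} {f₀ f₁ f₂ : ℝ → ℝ}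

lemma integrable_ruleDrift {μ : ℝ} (hP₁ : 0 < P₁) (hP₂ : 0 < P₂) (hμ : μ ∈ Icc (1 / 2 : ℝ) 1)
    (hf₀ : IsGainDensity f₀) (hf₁ : IsGainDensity f₁) (hf₂ : IsGainDensity f₂) :
    Integrable (ruleDrift P₁ P₂ μ) (fadingLaw f₀ f₁ f₂) :=
  integrable_of_le_rateBound hf₀ hf₁ hf₂ (measurable_ruleDrift P₁ P₂ μ)
    fun _ hs => abs_ruleDrift_le hP₁ hP₂ hμ hs

/-- Dominated convergence. The null set of states with ties may depend on `μ₀`, which is harmless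
because continuity is checked at one weight at a time. -/
lemma continuousOn_integral_ruleDrift (hP₁ : 0 < P₁) (hP₂ : 0 < P₂)
    (hf₀ : IsGainDensity f₀) (hf₁ : IsGainDensity f₁) (hf₂ : IsGainDensity f₂) :
    ContinuousOn (fun μ => ∫ s, ruleDrift P₁ P₂ μ s ∂(fadingLaw f₀ f₁ f₂)) (Icc (1 / 2) 1) := by
  intro μ₀ hμ₀
  have hpos := ae_mem_posStates hf₀ hf₁ hf₂
  refine continuousWithinAt_of_dominated (bound := rateBound P₁ P₂) ?_ ?_
    (integrable_rateBound P₁ P₂ hf₀ hf₁ hf₂) ?_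
  · exact Filter.Eventually.of_forall fun μ => (measurable_ruleDrift P₁ P₂ μ).aestronglyMeasurable
  · filter_upwards [self_mem_nhdsWithin] with μ hμ
    exact hpos.mono fun s hs => abs_ruleDrift_le hP₁ hP₂ hμ hs
  · filter_upwards [hpos, ae_injective_ruleMetric hP₁ hP₂ hμ₀ hf₀ hf₁ hf₂] with s hs hinj
    exact continuousWithinAt_ruleDrift hP₁ hP₂ hμ₀ hs hinj

/-- Almost sure uniqueness of the best mode forces every protocol that follows the rule to select
`ruleMode`. Hence one weight serves all such protocols, whatever their tie-breaking and codeword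
splits. -/
lemma Protocol.FollowsRule.balanceEquation_iff {μ : ℝ} {p : Protocol} (h : p.FollowsRule P₁ P₂ μ)
    (hp : p.Admissible) (hP₁ : 0 < P₁) (hP₂ : 0 < P₂) (hμ : μ ∈ Icc (1 / 2 : ℝ) 1)
    (hf₀ : IsGainDensity f₀) (hf₁ : IsGainDensity f₁) (hf₂ : IsGainDensity f₂) :
    p.BalanceEquation (fadingLaw f₀ f₁ f₂) P₁ P₂ ↔
      ∫ s, ruleDrift P₁ P₂ μ s ∂(fadingLaw f₀ f₁ f₂) = 0 := by
  unfold Protocol.BalanceEquation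
  rw [integral_congr_ae]
  filter_upwards [ae_mem_posStates hf₀ hf₁ hf₂,
    ae_injective_ruleMetric hP₁ hP₂ hμ hf₀ hf₁ hf₂] with s hs hinj
  obtain ⟨k, hk, hj⟩ := hp.q.exists_mode hs
  have hmax := h.mode s hs k hk
  rw [h.metric_eq hp hP₁ hP₂ hμ hs] at hmax
  have hkm : ruleMode P₁ P₂ μ s = k :=
    hinj (le_antisymm (hmax _) (ruleMetric_le_ruleMode P₁ P₂ μ s k))
  obtain ⟨h1, h2⟩ := h.rates hp hP₁ hP₂ hμ hs
  rw [ruleDrift, hkm, ← h1, ← h2]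
  have e : p.q 0 s * (p.C12c P₁ s - p.C1dc P₁ s) + p.q 1 s * (p.C21c P₂ s - p.C2dc P₂ s)
      + p.q 2 s * (p.Csumnc P₁ P₂ s - p.Csumc P₁ P₂ s) =
      ∑ j, p.q j s * (![p.C12c P₁ s, p.C21c P₂ s, p.Csumnc P₁ P₂ s] j -
        ![p.C1dc P₁ s, p.C2dc P₂ s, p.Csumc P₁ P₂ s] j) := by
    simp [Fin.sum_univ_three]
  rw [e, Finset.sum_eq_single k (fun j _ hjk => by rw [hj j hjk, zero_mul]) (by simp), hk, one_mul]

/-- An integrable function which is nonnegative on the states with positive gains, and positive on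
a set of positive probability, has a positive mean. -/
lemma integral_pos_of_pos_on (hf₀ : IsGainDensity f₀) (hf₁ : IsGainDensity f₁)
    (hf₂ : IsGainDensity f₂) {g : State → ℝ} (hg : Integrable g (fadingLaw f₀ f₁ f₂))
    (h0 : ∀ s ∈ posStates, 0 ≤ g s) {E : Set State} (hE : 0 < fadingLaw f₀ f₁ f₂ E)
    (hpos : ∀ s ∈ posStates, s ∈ E → 0 < g s) : 0 < ∫ s, g s ∂(fadingLaw f₀ f₁ f₂) := by
  have hae := ae_mem_posStates hf₀ hf₁ hf₂
  rw [integral_pos_iff_support_of_nonneg_ae (hae.mono h0) hg]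
  refine hE.trans_le (measure_mono_ae ?_)
  filter_upwards [hae] with s hs hsE
  exact (hpos s hs hsE).ne'

/-! ### Signs of the drift at the two end weights -/

lemma share_half {x y : ℝ} (hx : 0 < x) (hy : 0 < y) :
    shareLeft (1 / 2) x y = 0 ∧ shareRight (1 / 2) x y = 0 := by
  have h : LinRegion (1 / 2) x y := by simp [LinRegion, hx.le, hy.le]
  rw [shareLeft_of_lin h, shareRight_of_lin h]
  simp

/-- At weight `1/2` mode `M₃` uses no cooperation, so it leaves the queue unchanged. If `M₁` or `M₂`
is selected, the average of its relay and destination rates is at least `Cap (x + y)`, which exceeds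
the destination rate; so the relay rate is the larger one. In an exchange state `M₃` is not
selected. -/
lemma ruleDrift_half {s : State} (hP₁ : 0 < P₁) (hP₂ : 0 < P₂) (hs : s ∈ posStates) :
    0 ≤ ruleDrift P₁ P₂ (1 / 2) s ∧
      (s ∈ exchangeStates P₁ P₂ → 0 < ruleDrift P₁ P₂ (1 / 2) s) := by
  have x1 := mul_pos hP₁ hs.2.1
  have y2 := mul_pos hP₂ hs.2.2
  obtain ⟨e1, e2⟩ := share_half x1 y2
  have hmax := ruleMetric_le_ruleMode P₁ P₂ (1 / 2) s
  have m0 : ruleMetric P₁ P₂ (1 / 2) s 0 = (Cap (P₁ * s.1) + Cap (P₁ * s.2.1)) / 2 := by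
    simp only [ruleMetric, relayRate, destRate, Matrix.cons_val_zero]; ring
  have m1 : ruleMetric P₁ P₂ (1 / 2) s 1 = (Cap (P₂ * s.1) + Cap (P₂ * s.2.2)) / 2 := by
    simp only [ruleMetric, relayRate, destRate, Matrix.cons_val_one]
    simp only [Matrix.cons_val_zero]; ring
  have m2 : ruleMetric P₁ P₂ (1 / 2) s 2 = Cap (P₁ * s.2.1 + P₂ * s.2.2) := by
    simp only [ruleMetric, relayRate, destRate, Matrix.cons_val, e1, e2, ncRate_zero,
      coopRate_zero]
    ring
  have hcx : Cap (P₁ * s.2.1) < Cap (P₁ * s.2.1 + P₂ * s.2.2) := Cap_lt x1.le (by linarith)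
  have hcy : Cap (P₂ * s.2.2) < Cap (P₁ * s.2.1 + P₂ * s.2.2) := Cap_lt y2.le (by linarith)
  have hex : s ∈ exchangeStates P₁ P₂ → Cap (P₁ * s.2.1 + P₂ * s.2.2)
      < ruleMetric P₁ P₂ (1 / 2) s (ruleMode P₁ P₂ (1 / 2) s) := by
    rintro (h | h)
    · exact h.trans_le (m0 ▸ hmax 0)
    · exact h.trans_le (m1 ▸ hmax 1)
  have h2 := hmax 2
  rw [m2] at h2
  unfold ruleDrift
  generalize ruleMode P₁ P₂ (1 / 2) s = k at *
  fin_cases k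
  · change _ ≤ ruleMetric P₁ P₂ (1 / 2) s 0 at h2
    rw [m0] at h2
    have : 0 < Cap (P₁ * s.1) - Cap (P₁ * s.2.1) := by linarith
    exact ⟨this.le, fun _ => this⟩
  · change _ ≤ ruleMetric P₁ P₂ (1 / 2) s 1 at h2
    rw [m1] at h2
    have : 0 < Cap (P₂ * s.1) - Cap (P₂ * s.2.2) := by linarith
    exact ⟨this.le, fun _ => this⟩
  · refine ⟨?_, fun h => absurd (hex h) (not_lt.2 m2.le)⟩
    change 0 ≤ ncRate _ _ _ _ - coopRate _ _ _ _
    rw [e1, e2, ncRate_zero, coopRate_zero, sub_self]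

/-- At weight one `M₃` always wins with full cooperation: nothing enters the queue, while the
destination rate is positive. -/
lemma ruleDrift_one {s : State} (hP₁ : 0 < P₁) (hP₂ : 0 < P₂) (hs : s ∈ posStates) :
    ruleDrift P₁ P₂ 1 s < 0 := by
  have x1 := mul_pos hP₁ hs.2.1
  have y2 := mul_pos hP₂ hs.2.2
  obtain ⟨e1, e2⟩ := share_one x1 y2
  obtain ⟨h0, h1⟩ := ruleMetric_one_lt hP₁ hP₂ hs
  have hmode : ruleMode P₁ P₂ 1 s = 2 := by
    have h2 := ruleMetric_le_ruleMode P₁ P₂ 1 s 2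
    generalize ruleMode P₁ P₂ 1 s = k at *
    fin_cases k
    · exact absurd h2 (not_le.2 h0)
    · exact absurd h2 (not_le.2 h1)
    · rfl
  rw [ruleDrift, hmode]
  change ncRate _ _ _ _ - coopRate _ _ _ _ < 0
  rw [e1, e2, sub_neg]
  unfold ncRate coopRate
  refine Cap_lt (by simp) ?_
  have := Real.sqrt_nonneg (1 * 1 * (P₁ * s.2.1 * (P₂ * s.2.2)))
  simp only [sub_self, zero_mul, add_zero]
  linarith

/-- The strict signs at both ends keep the zero of the mean drift inside the open interval. -/
lemma exists_weight (hP₁ : 0 < P₁) (hP₂ : 0 < P₂) (hf₀ : IsGainDensity f₀)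
    (hf₁ : IsGainDensity f₁) (hf₂ : IsGainDensity f₂)
    (hE : 0 < fadingLaw f₀ f₁ f₂ (exchangeStates P₁ P₂)) :
    ∃ μ ∈ Ioo (1 / 2 : ℝ) 1, ∫ s, ruleDrift P₁ P₂ μ s ∂(fadingLaw f₀ f₁ f₂) = 0 := by
  have := isProbabilityMeasure_fadingLaw hf₀ hf₁ hf₂
  have hhalf : 0 < ∫ s, ruleDrift P₁ P₂ (1 / 2) s ∂(fadingLaw f₀ f₁ f₂) :=
    integral_pos_of_pos_on hf₀ hf₁ hf₂
      (integrable_ruleDrift hP₁ hP₂ (by norm_num) hf₀ hf₁ hf₂)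
      (fun s hs => (ruleDrift_half hP₁ hP₂ hs).1) hE (fun s hs => (ruleDrift_half hP₁ hP₂ hs).2)
  have hone : 0 < ∫ s, -ruleDrift P₁ P₂ 1 s ∂(fadingLaw f₀ f₁ f₂) :=
    integral_pos_of_pos_on hf₀ hf₁ hf₂
      (integrable_ruleDrift hP₁ hP₂ (by norm_num) hf₀ hf₁ hf₂).neg
      (fun s hs => (neg_pos.2 (ruleDrift_one hP₁ hP₂ hs)).le) (E := univ) (by simp)
      (fun s hs _ => neg_pos.2 (ruleDrift_one hP₁ hP₂ hs))
  rw [integral_neg] at hone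
  obtain ⟨μ, hμ, h0⟩ := intermediate_value_Ioo' (by norm_num : (1 / 2 : ℝ) ≤ 1)
    (continuousOn_integral_ruleDrift hP₁ hP₂ hf₀ hf₁ hf₂) ⟨by linarith, hhalf⟩
  exact ⟨μ, hμ, h0⟩

end Law

end Backhaul

end

/-! ### The main theorem -/

theorem theorem1 (P₁ P₂ : ℝ) (hP₁ : 0 < P₁) (hP₂ : 0 < P₂) (f₀ f₁ f₂ : ℝ → ℝ)
    (hf₀ : Backhaul.IsGainDensity f₀) (hf₁ : Backhaul.IsGainDensity f₁)
    (hf₂ : Backhaul.IsGainDensity f₂) :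
    -- for each weight the rule is well defined: the regions cover all states, some admissible
    -- protocol follows the rule, and the best mode is almost surely unique;
    -- a protocol that follows the rule and satisfies the balance equation is optimal
    (∀ μ ∈ Set.Ioo (1 / 2 : ℝ) 1,
      (Backhaul.posStates ⊆ Backhaul.K₁ P₁ P₂ μ ∪ Backhaul.K₂ P₁ P₂ μ ∪
          Backhaul.K₃ P₁ P₂ μ ∪ Backhaul.K₄ P₁ P₂ μ) ∧
      (∃ p : Backhaul.Protocol, p.Admissible ∧ p.FollowsRule P₁ P₂ μ) ∧
      (∀ p : Backhaul.Protocol, p.Admissible → p.FollowsRule P₁ P₂ μ →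
        (∀ᵐ s ∂(Backhaul.fadingLaw f₀ f₁ f₂),
          ∃! k, ∀ j, p.metric P₁ P₂ μ s j ≤ p.metric P₁ P₂ μ s k) ∧
        (p.BalanceEquation (Backhaul.fadingLaw f₀ f₁ f₂) P₁ P₂ →
          p.IsOptimal (Backhaul.fadingLaw f₀ f₁ f₂) P₁ P₂))) ∧
    -- a weight which solves the balance equation exists
    (0 < Backhaul.fadingLaw f₀ f₁ f₂ (Backhaul.exchangeStates P₁ P₂) →
      ∃ μ ∈ Set.Ioo (1 / 2 : ℝ) 1, ∀ p : Backhaul.Protocol, p.Admissible →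
        p.FollowsRule P₁ P₂ μ → p.BalanceEquation (Backhaul.fadingLaw f₀ f₁ f₂) P₁ P₂) := by
  refine ⟨fun μ hμ => ?_, fun hE => ?_⟩
  · have hμ' := Set.Ioo_subset_Icc_self hμ
    refine ⟨fun s hs => ?_, ⟨_, Backhaul.admissible_ruleProtocol hP₁ hP₂ hμ',
      Backhaul.followsRule_ruleProtocol hP₁ hP₂ hμ'.1⟩, fun p hp h => ⟨?_, fun hbal =>
      h.isOptimal hp hP₁ hP₂ hμ' hf₀ hf₁ hf₂ hbal⟩⟩
    · rcases Backhaul.region_cover (μ := μ) (mul_pos hP₁ hs.2.1) (mul_pos hP₂ hs.2.2) with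
        hr | hr | hr | hr
      · exact Or.inl (Or.inl (Or.inl hr))
      · exact Or.inl (Or.inl (Or.inr hr))
      · exact Or.inl (Or.inr hr)
      · exact Or.inr hr
    · filter_upwards [Backhaul.ae_mem_posStates hf₀ hf₁ hf₂,
        Backhaul.ae_injective_ruleMetric hP₁ hP₂ hμ' hf₀ hf₁ hf₂] with s hs hinj
      rw [h.metric_eq hp hP₁ hP₂ hμ' hs]
      have hmax := Backhaul.ruleMetric_le_ruleMode P₁ P₂ μ s
      exact ⟨_, hmax, fun k hk => hinj (le_antisymm (hmax k) (hk _))⟩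
  · obtain ⟨μ, hμ, h0⟩ := Backhaul.exists_weight hP₁ hP₂ hf₀ hf₁ hf₂ hE
    exact ⟨μ, hμ, fun p hp h =>
      (h.balanceEquation_iff hp hP₁ hP₂ (Set.Ioo_subset_Icc_self hμ) hf₀ hf₁ hf₂).2 h0⟩
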